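/- **Theorem 2.6.** Let $(M^2,g)$ be an oriented $C^\infty$ Riemannian 2-manifold with unit area form $\Omega_g$, and write $[v,w]=\Omega_g(v,w)$. For a $C^\infty$ curve $\gamma$ in $M$ let $\dot\gamma$ be its velocity, $\ddot\gamma=\nabla_t\dot\gamma$ and $\gamma^{(3)}=\nabla_t\ddot\gamma$, where $\nabla_t$ is the Levi-Civita covariant derivative along $\gamma$, and put $$s_g(t)=\int_0^t|\dot\gamma(u)|\,du,\qquad \kappa_g=\frac{[\dot\gamma,\ddot\gamma]}{|\dot\gamma|^3}\ \text{ where } \dot\gamma\neq0,\qquad \tau(t)=\operatorname{sgn}(t)\sqrt{|s_g(t)|}.$$ The curve has a *3/2-cusp* at $t=0$ if there are a local diffeomorphism $\Phi$ from $M$ at $\gamma(0)$ to $\mathbf R^2$ and a local coordinate change $t=\sigma(s)$ with $\sigma(0)=0$ such that $\Phi(\gamma(\sigma(s)))=(s^2,s^3)$ for $s$ near $0$; its *cuspidal curvature* is then $\mu_g=[\ddot\gamma(0),\gamma^{(3)}(0)]/|\ddot\gamma(0)|^{5/2}$. (1) Let $\gamma:(-\delta,\delta)\to M$ ($\delta>0$)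 be a $C^\infty$ curve with a 3/2-cusp at $t=0$. Then $\tau$ is a local $C^\infty$ coordinate of the curve at $t=0$ (the *half-arclength parameter*); $\dot\gamma(t)\ne0$ for all sufficiently small $t\neq0$; the function $\sqrt{|s_g|}\,\kappa_g$, defined for small $t\ne0$, extends to a $C^\infty$ function of $t$, and also to a $C^\infty$ function of $\tau$, near $0$; and $$\lim_{t\to0}\sqrt{|s_g|}\,\kappa_g=\frac{\mu_g}{2\sqrt2}.$$ (2) Conversely, let $p\in M$, $\varepsilon>0$, and let $f:(-\varepsilon,\varepsilon)\to\mathbf R$ be a $C^\infty$ function with $f(0)\neq0$. Then there are $\delta\in(0,\varepsilon]$ and a $C^\infty$ curve $\gamma:(-\delta,\delta)\to M$ with $\gamma(0)=p$ and a 3/2-cusp at $0$, whose parameter is the half-arclength parameter, i.e. $\tau(t)=t$ for all $t\in(-\delta,\delta)$, and such that for all $t\in(-\delta,\delta)$ with $t\neq0$ one has $\dot\gamma(t)\ne0$ and $\sqrt{|s_g(t)|}\,\kappa_g(t)=f(t)$. -/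

import Mathlib

open Set Filter Topology Manifold Bundle
open scoped ContDiff

noncomputable section

namespace CuspCurvature

/-- The coordinate plane, on which surfaces are modelled. -/
abbrev Plane : Type := EuclideanSpace ℝ (Fin 2)

section Smooth

variable {M : Type*} [TopologicalSpace M] [ChartedSpace Plane M]

/-- `t = 0` is a 3/2-cusp of the curve `γ`: after a local diffeomorphism `Φ` of the surface at
`γ 0` and a local coordinate change `t = σ s` of the parameter with `σ 0 = 0`, the curve becomes
the germ at `0` of `s ↦ (s ^ 2, s ^ 3)`. -/
def IsThreeHalvesCusp (γ : ℝ → M) : Prop :=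
  ∃ (Φ : M → Plane) (σ : ℝ → ℝ),
    IsLocalDiffeomorphAt (𝓡 2) (𝓡 2) ∞ Φ (γ 0) ∧
    IsLocalDiffeomorphAt 𝓘(ℝ, ℝ) 𝓘(ℝ, ℝ) ∞ σ 0 ∧ σ 0 = 0 ∧
    ∀ᶠ s in 𝓝 (0 : ℝ), Φ (γ (σ s)) = !₂[s ^ 2, s ^ 3]

variable [IsManifold (𝓡 2) ∞ M]

/-- The tangent bundle trivialization given by the preferred chart at `p`: it sends a tangent
vector to its pair of components in the coordinates of that chart. -/
abbrev chartTriv (p : M) :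
    Trivialization Plane (π Plane (TangentSpace (𝓡 2) : M → Type _)) :=
  trivializationAt Plane (TangentSpace (𝓡 2)) p

/-- The linear isomorphism from the tangent space at `q` to the plane that sends a tangent vector
to its components in the chart at `p`; here `q` lies in the domain of that chart. -/
def componentEquiv (p q : M) (hq : q ∈ (chartAt Plane p).source) :
    TangentSpace (𝓡 2) q ≃ₗ[ℝ] Plane :=
  ((chartTriv p).continuousLinearEquivAt ℝ q hq).toLinearEquiv

/-- The `i`-th coordinate vector field of the chart at `p`, evaluated at `q`. -/
def coordVec (p q : M) (i : Fin 2) : TangentSpace (𝓡 2) q :=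
  (chartTriv p).symmL ℝ q (EuclideanSpace.single i 1)

variable (M) in
/-- An orientation of a surface: an orientation of every tangent space, locally constant in
charts. -/
structure SurfaceOrientation where
  orient : ∀ p : M, Orientation ℝ (TangentSpace (𝓡 2) p) (Fin 2)
  locallyConstant : ∀ p : M, ∀ᶠ q in 𝓝 p, ∀ hq : q ∈ (chartAt Plane p).source,
    Orientation.map (Fin 2) (componentEquiv p q hq) (orient q) =
      Orientation.map (Fin 2) (componentEquiv p p (mem_chart_source Plane p)) (orient p)

/-- The velocity vector of a curve. -/
def velocity (γ : ℝ → M) (t : ℝ) : TangentSpace (𝓡 2) (γ t) :=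
  mfderiv 𝓘(ℝ, ℝ) (𝓡 2) γ t (1 : ℝ)

end Smooth

section Riemannian

variable {M : Type*} [TopologicalSpace M] [ChartedSpace Plane M] [IsManifold (𝓡 2) ∞ M]
  [RiemannianBundle (fun p : M ↦ TangentSpace (𝓡 2) p)]

/-- The matrix `(g_ij)` of the metric in the coordinates of the chart at `p`, at the point with
coordinates `y`. -/
def metricMatrix (p : M) (y : Plane) : Matrix (Fin 2) (Fin 2) ℝ :=
  Matrix.of fun i j ↦
    inner ℝ (coordVec p ((extChartAt (𝓡 2) p).symm y) i)
      (coordVec p ((extChartAt (𝓡 2) p).symm y) j)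

/-- The partial derivative `∂ₖ g_ij` in the chart at `p`, at the point with coordinates `y`. -/
def metricDeriv (p : M) (y : Plane) (k i j : Fin 2) : ℝ :=
  fderiv ℝ (fun z ↦ metricMatrix p z i j) y (EuclideanSpace.single k 1)

/-- The Christoffel symbol `Γᵏ_ij` of the Levi-Civita connection in the chart at `p`, at the point
with coordinates `y`. -/
def christoffel (p : M) (y : Plane) (k i j : Fin 2) : ℝ :=
  (1 / 2) * ∑ l, (metricMatrix p y)⁻¹ k l *
    (metricDeriv p y i j l + metricDeriv p y j i l - metricDeriv p y l i j)

/-- The components, in the chart at `p`, of the Levi-Civita covariant derivative at time `t` of a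
vector field `X` along the curve `γ`:
`(∇_t X)ᵏ = dXᵏ/dt + ∑ i j, Γᵏ_ij (dγⁱ/dt) Xʲ`. -/
def covDerivComponents (p : M) (γ : ℝ → M) (X : ∀ t, TangentSpace (𝓡 2) (γ t)) (t : ℝ) : Plane :=
  let x : ℝ → Plane := fun s ↦ extChartAt (𝓡 2) p (γ s)
  let ξ : ℝ → Plane := fun s ↦ (chartTriv p).continuousLinearMapAt ℝ (γ s) (X s)
  WithLp.toLp 2 fun k ↦
    deriv ξ t k + ∑ i, ∑ j, christoffel p (x t) k i j * deriv x t i * ξ t j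

/-- The Levi-Civita covariant derivative `∇_t X` of a vector field `X` along the curve `γ`,
computed at time `t` in the preferred chart at `γ t`. -/
def covDeriv (γ : ℝ → M) (X : ∀ t, TangentSpace (𝓡 2) (γ t)) (t : ℝ) :
    TangentSpace (𝓡 2) (γ t) :=
  (chartTriv (γ t)).symmL ℝ (γ t) (covDerivComponents (γ t) γ X t)

/-- `γ̈ = ∇_t γ̇`. -/
def acceleration (γ : ℝ → M) : ∀ t, TangentSpace (𝓡 2) (γ t) := covDeriv γ (velocity γ)

/-- `γ⁽³⁾ = ∇_t γ̈`. -/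
def thirdDeriv (γ : ℝ → M) : ∀ t, TangentSpace (𝓡 2) (γ t) := covDeriv γ (acceleration γ)

instance finrank_tangentSpace (p : M) :
    Fact (Module.finrank ℝ (TangentSpace (𝓡 2) p) = 2) :=
  ⟨(finrank_euclideanSpace_fin : Module.finrank ℝ Plane = 2)⟩

/-- `[v, w] = Ω_g(v, w)`, where `Ω_g` is the unit area form of the oriented Riemannian surface. -/
def bracket (o : SurfaceOrientation M) {p : M} (v w : TangentSpace (𝓡 2) p) : ℝ :=
  (o.orient p).areaForm v w

/-- The signed arclength `s_g(t) = ∫₀ᵗ |γ̇(u)| du`. -/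
def arclength (γ : ℝ → M) (t : ℝ) : ℝ := ∫ u in (0 : ℝ)..t, ‖velocity γ u‖

/-- The half-arclength function `τ(t) = sgn(t) √|s_g(t)|`. -/
def halfArclength (γ : ℝ → M) (t : ℝ) : ℝ := Real.sign t * √|arclength γ t|

/-- The geodesic curvature `κ_g = [γ̇, γ̈] / |γ̇|³` (meaningful where `γ̇ ≠ 0`). -/
def geodesicCurvature (o : SurfaceOrientation M) (γ : ℝ → M) (t : ℝ) : ℝ :=
  bracket o (velocity γ t) (acceleration γ t) / ‖velocity γ t‖ ^ 3

/-- The normalized curvature `√|s_g| κ_g` (meaningful where `γ̇ ≠ 0`). -/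
def normalizedCurvature (o : SurfaceOrientation M) (γ : ℝ → M) (t : ℝ) : ℝ :=
  √|arclength γ t| * geodesicCurvature o γ t

/-- The cuspidal curvature `μ_g = [γ̈(0), γ⁽³⁾(0)] / |γ̈(0)|^(5/2)`. -/
def cuspidalCurvature (o : SurfaceOrientation M) (γ : ℝ → M) : ℝ :=
  bracket o (acceleration γ 0) (thirdDeriv γ 0) / ‖acceleration γ 0‖ ^ (5 / 2 : ℝ)

end Riemannian

end CuspCurvature

end

/-! In the chart at `γ 0` a cusp satisfies x' = t w(t) with w smooth and w(0) ≠ 0. Write c = |w|_g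
and D = w' + t Γ(w, w), the covariant derivative of w along the curve. The speed is |t| c(t), so the
signed arclength is |t| t m(t), where m(t) = ∫₀¹ s c(st) ds is smooth and positive near 0. Hence τ =
t √m is smooth with τ'(0) ≠ 0. The acceleration is w + t D, so [γ̇, γ̈] = t² [w, D]; in √|s_g| κ_g
all powers of |t| cancel and √m [w, D] / c³ remains, which is smooth. At 0 one has γ̈ = w, γ⁽³⁾ = 2
w' and m = c / 2, and this gives the limit.

Conversely, c = 2 forces m = 1 and τ = t, and the normalized curvature is then [w, D] / 8. With J
the rotation by a right angle, D = 2 f J w gives the value f, because [w, J w] = |w|² = 4. Thus x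
and w have to solve the regular system x' = t w, w' = 2 f J w - t Γ(w, w), along which |w| is
constant (`exists_curve_in_chart`). Since f(0) ≠ 0, the vectors w(0) and w'(0) are independent.

That independence must still yield the normal form (s², s³) (`exists_cusp_normal_form`). After a
linear map and a change of parameter the curve is (s², s³ b(s)) with b(0) = 1. Whitney's theorem,
proved here from Borel's, splits b(s) = g(s²) + s h(s²), and (u, v) ↦ (u, (v - u² h(u)) / g(u))
straightens the curve.

As ∇_t is defined through the chart at the moving point, the acceleration is first shown to have the
same formula in one fixed chart (`components_acceleration`). The argument goes through the Koszul
formula. -/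

namespace CuspCurvature

/-! ### Radial means and Hadamard's lemma -/

section RadialMean

variable {E : Type*} [NormedAddCommGroup E] [NormedSpace ℝ E]

/-- The weighted mean `∫₀¹ sᵏ f(s t) ds` of `f` over the segment from `0` to `t`. -/
noncomputable def radialMean (k : ℕ) (f : ℝ → E) (t : ℝ) : E := ∫ s in (0 : ℝ)..1, s ^ k • f (s * t)

/-- Differentiation under the integral sign raises the weight by one and stays in the same family,
so smoothness follows by induction with k arbitrary. -/
theorem hasDerivAt_radialMean [CompleteSpace E] (k : ℕ) {f : ℝ → E} (hf : ContDiff ℝ 1 f) (t : ℝ) :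
    HasDerivAt (radialMean k f) (radialMean (k + 1) (deriv f) t) t := by
  have hf' : Continuous (deriv f) := hf.continuous_deriv le_rfl
  obtain ⟨C, hC⟩ := (isCompact_Icc (a := -(|t| + 1)) (b := |t| + 1)).exists_bound_of_continuousOn
    hf'.continuousOn
  refine (intervalIntegral.hasDerivAt_integral_of_dominated_loc_of_deriv_le
    (F := fun x s ↦ s ^ k • f (s * x)) (F' := fun x s ↦ s ^ (k + 1) • deriv f (s * x))
    (bound := fun _ ↦ C) (Metric.ball_mem_nhds t one_pos) ?_ ?_ ?_ ?_ ?_ ?_).2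
  · refine .of_forall fun x ↦ Continuous.aestronglyMeasurable ?_
    exact (continuous_id.pow k).smul (hf.continuous.comp (continuous_id.mul continuous_const))
  · exact ((continuous_id.pow k).smul
      (hf.continuous.comp (continuous_id.mul continuous_const))).intervalIntegrable _ _
  · refine Continuous.aestronglyMeasurable ?_
    exact (continuous_id.pow _).smul (hf'.comp (continuous_id.mul continuous_const))
  · refine .of_forall fun s hs x hx ↦ ?_
    rw [uIoc_of_le zero_le_one] at hs
    have h1 : |s| ≤ 1 := abs_le.2 ⟨by linarith [hs.1], hs.2⟩
    have h2 : |x| ≤ |t| + 1 := by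
      have : |x - t| < 1 := hx
      linarith [abs_sub_abs_le_abs_sub x t]
    have h3 : |s * x| ≤ |t| + 1 := by
      rw [abs_mul]; nlinarith [abs_nonneg s, abs_nonneg x]
    rw [norm_smul, norm_pow, Real.norm_eq_abs]
    have h4 := hC (s * x) (abs_le.1 h3)
    have h5 : |s| ^ (k + 1) ≤ 1 := pow_le_one₀ (abs_nonneg s) h1
    nlinarith [norm_nonneg (deriv f (s * x)), pow_nonneg (abs_nonneg s) (k + 1)]
  · exact intervalIntegrable_const
  · refine .of_forall fun s _ x _ ↦ ?_
    have h1 : HasDerivAt (fun x : ℝ ↦ s * x) s x := by simpa using (hasDerivAt_id x).const_mul s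
    have h2 := (((hf.differentiable one_ne_zero) (s * x)).hasDerivAt.scomp x h1).const_smul (s ^ k)
    rw [← mul_smul, ← pow_succ] at h2
    exact h2

theorem contDiff_radialMean [CompleteSpace E] (k : ℕ) {f : ℝ → E} (hf : ContDiff ℝ ∞ f) :
    ContDiff ℝ ∞ (radialMean k f) := by
  refine contDiff_infty.2 fun n ↦ ?_
  induction n generalizing k f with
  | zero =>
    exact contDiff_zero.2 (continuous_iff_continuousAt.2 fun t ↦
      (hasDerivAt_radialMean k (hf.of_le (by simp)) t).continuousAt)
  | succ n ih =>
    have h := hasDerivAt_radialMean k (hf.of_le (m := 1) (by simp))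
    rw [Nat.cast_succ]
    refine contDiff_succ_iff_deriv.2 ⟨fun t ↦ (h t).differentiableAt, by simp, ?_⟩
    rw [show deriv (radialMean k f) = radialMean (k + 1) (deriv f) from funext fun t ↦ (h t).deriv]
    exact ih (k + 1) (contDiff_infty_iff_deriv.1 hf).2

theorem radialMean_zero [CompleteSpace E] (k : ℕ) (f : ℝ → E) :
    radialMean k f 0 = (k + 1 : ℝ)⁻¹ • f 0 := by
  have h : (∫ s in (0 : ℝ)..1, s ^ k) = (k + 1 : ℝ)⁻¹ := by
    rw [integral_pow]; simp
  simp only [radialMean, mul_zero]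
  rw [intervalIntegral.integral_smul_const, h]

theorem intervalIntegral_pow_smul_eq_radialMean (k : ℕ) (f : ℝ → E) (t : ℝ) :
    ∫ u in (0 : ℝ)..t, u ^ k • f u = t ^ (k + 1) • radialMean k f t := by
  have h := intervalIntegral.smul_integral_comp_mul_right (a := 0) (b := 1)
    (fun u : ℝ ↦ u ^ k • f u) t
  rw [zero_mul, one_mul] at h
  rw [← h, radialMean, pow_succ', mul_smul, ← intervalIntegral.integral_smul (t ^ k)]
  congr 1
  refine intervalIntegral.integral_congr fun s _ ↦ ?_
  simp only [mul_pow, smul_smul, mul_comm]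

/-- Hadamard's lemma: the radial mean of f' is the quotient (f(t) - f(0)) / t, extended smoothly
over t = 0. -/
theorem eq_add_smul_radialMean [CompleteSpace E] {f : ℝ → E} (hf : ContDiff ℝ 1 f) (t : ℝ) :
    f t = f 0 + t • radialMean 0 (deriv f) t := by
  have h := intervalIntegral_pow_smul_eq_radialMean 0 (deriv f) t
  simp only [pow_zero, one_smul, zero_add, pow_one] at h
  rw [← h, intervalIntegral.integral_deriv_eq_sub'
    _ rfl (fun x _ ↦ hf.differentiable one_ne_zero x)
    (hf.continuous_deriv le_rfl).continuousOn]
  abel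

end RadialMean

/-- Multiplication by a bump function makes a local function global. Radial means and Whitney's
theorem can then be stated for globally smooth functions only. -/
theorem exists_contDiff_eventuallyEq {E F : Type*} [NormedAddCommGroup E] [NormedSpace ℝ E]
    [FiniteDimensional ℝ E] [NormedAddCommGroup F] [NormedSpace ℝ F] {f : E → F} {s : Set E} {a : E}
    (hf : ContDiffOn ℝ ∞ f s) (hs : s ∈ 𝓝 a) : ∃ g : E → F, ContDiff ℝ ∞ g ∧ g =ᶠ[𝓝 a] f := by
  obtain ⟨r, hr, hrs⟩ := Metric.nhds_basis_closedBall.mem_iff.1 (interior_mem_nhds.2 hs)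
  let χ : ContDiffBump a := ⟨r / 2, r, by positivity, by linarith⟩
  refine ⟨fun x ↦ χ x • f x, contDiff_iff_contDiffAt.2 fun x ↦ ?_, ?_⟩
  · by_cases hx : x ∈ tsupport χ
    · have : x ∈ interior s := hrs (by simpa [χ.tsupport_eq] using hx)
      exact χ.contDiff.contDiffAt.smul (hf.contDiffAt (mem_interior_iff_mem_nhds.1 this))
    · have h : (fun x ↦ χ x • f x) =ᶠ[𝓝 x] fun _ ↦ 0 := by
        filter_upwards [notMem_tsupport_iff_eventuallyEq.1 hx] with y hy
        simp [hy]
      exact contDiffAt_const.congr_of_eventuallyEq h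
  · filter_upwards [χ.eventuallyEq_one] with x hx
    simp [hx]

/-! ### Borel's theorem on prescribed derivatives at a point -/

section Borel

/-- The Taylor series is cut off term by term: the n-th monomial is multiplied by a bump shrunk by a
factor `lam n`, chosen so large that every differentiated series converges uniformly. -/
theorem exists_contDiff_iteratedDeriv_zero_eq (c : ℕ → ℝ) :
    ∃ b : ℝ → ℝ, ContDiff ℝ ∞ b ∧ ∀ n, iteratedDeriv n b 0 = c n := by
  let χ : ContDiffBump (0 : ℝ) := ⟨1, 2, one_pos, one_lt_two⟩
  let ψ : ℕ → ℝ → ℝ := fun n v ↦ v ^ n * χ v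
  have hψ n : ContDiff ℝ ∞ (ψ n) := (contDiff_id.pow n).mul χ.contDiff
  have hψb k n : ∃ B, ∀ v, |iteratedDeriv k (ψ n) v| ≤ B := by
    have h1 : HasCompactSupport (ψ n) := χ.hasCompactSupport.mul_left
    have h2 := h1.iteratedFDeriv (𝕜 := ℝ) k
    obtain ⟨B, hB⟩ := h2.exists_bound_of_continuous
      ((hψ n).continuous_iteratedFDeriv (by exact_mod_cast le_top))
    exact ⟨B, fun v ↦ by
      rw [← Real.norm_eq_abs, ← norm_iteratedFDeriv_eq_norm_iteratedDeriv]; exact hB v⟩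
  choose B hB using hψb
  have hB0 k n : 0 ≤ B k n := (abs_nonneg _).trans (hB k n 0)
  let d : ℕ → ℝ := fun n ↦ c n / n.factorial
  -- For k < n this makes `lam n` at least 2ⁿ |d n| B k n, so the k-th derivative of the n-th term
  -- is at most 2⁻ⁿ. The summand 1 gives `lam n ≥ 1`.
  let lam : ℕ → ℝ := fun n ↦ 1 + 2 ^ n * |d n| * ∑ k ∈ Finset.range n, B k n
  have hlam n : 1 ≤ lam n := by
    have : 0 ≤ 2 ^ n * |d n| * ∑ k ∈ Finset.range n, B k n :=
      mul_nonneg (by positivity) (Finset.sum_nonneg fun k _ ↦ hB0 k n)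
    simp only [lam]; linarith
  let F : ℕ → ℝ → ℝ := fun n u ↦ (d n * (lam n)⁻¹ ^ n) * ψ n (lam n * u)
  have hF n : ContDiff ℝ ∞ (F n) :=
    contDiff_const.mul ((hψ n).comp (contDiff_const.mul contDiff_id))
  have hFk k n u : iteratedDeriv k (F n) u =
      (d n * (lam n)⁻¹ ^ n) * (lam n ^ k * iteratedDeriv k (ψ n) (lam n * u)) := by
    have h1 : iteratedDeriv k (fun u ↦ ψ n (lam n * u)) =
        fun u ↦ lam n ^ k * iteratedDeriv k (ψ n) (lam n * u) :=
      iteratedDeriv_comp_const_mul ((hψ n).of_le (by exact_mod_cast le_top)) (lam n)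
    simp only [F]
    rw [iteratedDeriv_const_mul_field, h1]
  -- The geometric bound fails only for the finitely many n ≤ k, where any finite bound will do.
  let v : ℕ → ℕ → ℝ := fun k n ↦ (1 / 2) ^ n +
    if n ≤ k then |d n * (lam n)⁻¹ ^ n| * (lam n ^ k * B k n) else 0
  have hv k : Summable (v k) := by
    refine summable_geometric_two.add
      (summable_of_ne_finset_zero (s := Finset.range (k + 1)) fun n hn ↦ if_neg ?_)
    simpa using hn
  have hFv k n u : ‖iteratedFDeriv ℝ k (F n) u‖ ≤ v k n := by
    rw [norm_iteratedFDeriv_eq_norm_iteratedDeriv, Real.norm_eq_abs, hFk, abs_mul]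
    have hl := hlam n
    have hl0 : 0 < lam n := by linarith
    by_cases hkn : n ≤ k
    · simp only [v, if_pos hkn]
      have : |lam n ^ k * iteratedDeriv k (ψ n) (lam n * u)| ≤ lam n ^ k * B k n := by
        rw [abs_mul, abs_of_pos (pow_pos hl0 k)]
        exact mul_le_mul_of_nonneg_left (hB _ _ _) (pow_pos hl0 k).le
      have h2 : (0 : ℝ) ≤ (1 / 2) ^ n := by positivity
      have := mul_le_mul_of_nonneg_left this (abs_nonneg (d n * (lam n)⁻¹ ^ n))
      linarith
    · simp only [v, if_neg hkn, add_zero]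
      push Not at hkn
      obtain ⟨m, rfl⟩ := Nat.exists_eq_add_of_lt hkn
      set n := k + m + 1
      have h1 : |d n * (lam n)⁻¹ ^ n| * |lam n ^ k * iteratedDeriv k (ψ n) (lam n * u)| ≤
          |d n| * (lam n)⁻¹ ^ n * (lam n ^ k * B k n) := by
        rw [abs_mul, abs_mul, abs_of_pos (pow_pos hl0 k), abs_of_pos (pow_pos (inv_pos.2 hl0) n)]
        gcongr
        exact hB _ _ _
      have h2 : (lam n)⁻¹ ^ n * lam n ^ k = (lam n)⁻¹ ^ m * (lam n)⁻¹ := by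
        have h (l : ℝ) (hl : l ≠ 0) : l⁻¹ ^ (k + m + 1) * l ^ k = l⁻¹ ^ m * l⁻¹ := by
          rw [pow_add, pow_add, inv_pow, inv_pow]
          field_simp
        exact h _ hl0.ne'
      have h3 : (lam n)⁻¹ ^ m ≤ 1 := pow_le_one₀ (inv_pos.2 hl0).le (inv_le_one_of_one_le₀ hl)
      have h4 : B k n ≤ ∑ k ∈ Finset.range n, B k n :=
        Finset.single_le_sum (f := fun k ↦ B k n) (fun j _ ↦ hB0 j n)
          (Finset.mem_range.2 (by omega))
      have h5 : 2 ^ n * |d n| * B k n ≤ lam n := by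
        have : 2 ^ n * |d n| * B k n ≤ 2 ^ n * |d n| * ∑ k ∈ Finset.range n, B k n := by
          gcongr
        simp only [lam]; linarith
      calc _ ≤ _ := h1
        _ = (lam n)⁻¹ ^ m * ((lam n)⁻¹ * (|d n| * B k n)) := by
          linear_combination (|d n| * B k n) * h2
        _ ≤ 1 * ((lam n)⁻¹ * (|d n| * B k n)) := by
          have := hB0 k n
          gcongr
        _ ≤ (1 / 2) ^ n := by
          rw [one_mul, inv_mul_le_iff₀ hl0, one_div, inv_pow, ← div_eq_mul_inv,
            le_div_iff₀ (by positivity)]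
          linarith
  refine ⟨fun u ↦ ∑' n, F n u, ?_, fun k ↦ ?_⟩
  · exact contDiff_tsum (N := ⊤) hF (fun k _ ↦ hv k) fun k n u _ ↦ hFv k n u
  · have h1 := iteratedFDeriv_tsum_apply (N := ⊤) hF (fun k _ ↦ hv k) (fun k n u _ ↦ hFv k n u)
      (k := k) le_top 0
    have hs : Summable fun n ↦ iteratedFDeriv ℝ k (F n) 0 :=
      Summable.of_norm_bounded (hv k) fun n ↦ hFv k n 0
    rw [iteratedDeriv_eq_iteratedFDeriv, h1]
    have h2 := (ContinuousMultilinearMap.apply ℝ (fun _ : Fin k ↦ ℝ) ℝ (fun _ ↦ 1)).map_tsum hs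
    simp only [ContinuousMultilinearMap.apply_apply] at h2
    rw [h2]
    simp only [← iteratedDeriv_eq_iteratedFDeriv]
    have h3 n : iteratedDeriv k (F n) 0 = if n = k then c k else 0 := by
      have hψ0 : iteratedDeriv k (ψ n) 0 = if n = k then (n.factorial : ℝ) else 0 := by
        have : ψ n =ᶠ[𝓝 0] fun v ↦ v ^ n := by
          filter_upwards [χ.eventuallyEq_one] with v hv
          simp [ψ, hv]
        rw [this.iteratedDeriv_eq, iteratedDeriv_fun_pow_zero]
        by_cases h : n = k
        · simp [h]
        · simp [h, Ne.symm h]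
      have hl0 : lam n ≠ 0 := by linarith [hlam n]
      rw [hFk, mul_zero, hψ0]
      split_ifs with h
      · subst h
        simp only [d]
        have : (n.factorial : ℝ) ≠ 0 := by positivity
        rw [inv_pow]
        field_simp
      · simp
    simp only [h3]
    exact tsum_ite_eq k _

end Borel

/-! ### Whitney's theorem on even functions -/

section Even

theorem deriv_neg_of_even {f : ℝ → ℝ} (he : ∀ s, f (-s) = f s) (s : ℝ) :
    deriv f (-s) = -deriv f s := by
  have h := deriv_comp_neg (f := f) s
  rw [show (fun x ↦ f (-x)) = f from funext he] at h
  rw [h, neg_neg]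

/-- If `f` is smooth and even, `g s = f' s / (2 s)` is smooth and even. -/
theorem exists_deriv_eq_two_mul {f : ℝ → ℝ} (hf : ContDiff ℝ ∞ f) (he : ∀ s, f (-s) = f s) :
    ∃ g : ℝ → ℝ, (ContDiff ℝ ∞ g ∧ ∀ s, g (-s) = g s) ∧ ∀ s, deriv f s = 2 * s * g s := by
  have h1 := (contDiff_infty_iff_deriv.1 hf).2
  have h2 := (contDiff_infty_iff_deriv.1 h1).2
  have h0 : deriv f 0 = 0 := by
    have := deriv_neg_of_even he 0
    rw [neg_zero] at this
    linarith
  have h3 s : deriv (deriv f) (-s) = deriv (deriv f) s := by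
    have h := deriv_comp_neg (f := deriv f) s
    rw [show (fun x ↦ deriv f (-x)) = -deriv f from funext (deriv_neg_of_even he), deriv.neg] at h
    linarith
  refine ⟨fun s ↦ 2⁻¹ * radialMean 0 (deriv (deriv f)) s,
    ⟨contDiff_const.mul (contDiff_radialMean 0 h2), fun s ↦ ?_⟩, fun s ↦ ?_⟩
  · simp only [radialMean, mul_neg, h3]
  · have := eq_add_smul_radialMean (h1.of_le (m := 1) (by simp)) s
    rw [h0, zero_add, smul_eq_mul] at this
    rw [this]
    ring

/-- With u = s², d/du is (1 / 2s) d/ds, so g is the derivative of f regarded as a function of u. -/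
theorem hasDerivAt_comp_sqrt {f g : ℝ → ℝ} (hf : ContDiff ℝ ∞ f)
    (hfg : ∀ s, deriv f s = 2 * s * g s) {u : ℝ} (hu : 0 < u) :
    HasDerivAt (fun u ↦ f √u) (g √u) u := by
  have h1 := ((hf.differentiable (by simp)) √u).hasDerivAt.comp u (Real.hasDerivAt_sqrt hu.ne')
  have h2 : 0 < √u := Real.sqrt_pos.2 hu
  rw [hfg, show 2 * √u * g √u * (1 / (2 * √u)) = g √u by field_simp] at h1
  exact h1

/-- **Whitney's theorem on even functions**: a smooth even function is a smooth function of the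
square of the variable. -/
theorem exists_contDiff_eq_comp_sq {f : ℝ → ℝ} (hf : ContDiff ℝ ∞ f) (he : ∀ s, f (-s) = f s) :
    ∃ g : ℝ → ℝ, ContDiff ℝ ∞ g ∧ ∀ s, f s = g (s ^ 2) := by
  let S := {f : ℝ → ℝ // ContDiff ℝ ∞ f ∧ ∀ s, f (-s) = f s}
  have hT (f : S) : ∃ g : S, ∀ s, deriv f.1 s = 2 * s * g.1 s := by
    obtain ⟨g, hg, h⟩ := exists_deriv_eq_two_mul f.2.1 f.2.2
    exact ⟨⟨g, hg⟩, h⟩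
  choose T hT using hT
  -- `Q n`, evaluated at √u, is the n-th derivative of u ↦ f √u for u > 0; all of them extend
  -- continuously to u = 0.
  let Q : ℕ → S := fun n ↦ T^[n] ⟨f, hf, he⟩
  have hQ n s : deriv (Q n).1 s = 2 * s * (Q (n + 1)).1 s := by
    simp only [Q, Function.iterate_succ_apply']
    exact hT _ s
  -- For u < 0 the function is continued by some b with the same derivatives at 0; `G n` is the n-th
  -- derivative of the glued function.
  obtain ⟨b, hb, hb0⟩ := exists_contDiff_iteratedDeriv_zero_eq fun n ↦ (Q n).1 0
  let G : ℕ → ℝ → ℝ := fun n u ↦ if 0 ≤ u then (Q n).1 √u else iteratedDeriv n b u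
  have hbd n u : HasDerivAt (iteratedDeriv n b) (iteratedDeriv (n + 1) b u) u := by
    rw [iteratedDeriv_succ]
    exact (hb.differentiable_iteratedDeriv n (by exact_mod_cast WithTop.coe_lt_top _) u).hasDerivAt
  have hGpos n : EqOn (G n) (fun u ↦ (Q n).1 √u) (Ici 0) := fun u (hu : 0 ≤ u) ↦ if_pos hu
  have hGneg n : EqOn (G n) (iteratedDeriv n b) (Iic 0) := by
    intro u hu
    rcases (mem_Iic.1 hu).eq_or_lt with rfl | hu
    · simp [G, hb0]
    · exact if_neg (not_le.2 hu)
  have hG n u : HasDerivAt (G n) (G (n + 1) u) u := by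
    rcases lt_trichotomy u 0 with hu | rfl | hu
    · rw [hGneg (n + 1) hu.le]
      exact (hbd n u).congr_of_eventuallyEq ((hGneg n).eventuallyEq_of_mem (Iic_mem_nhds hu))
    -- The square root is not differentiable at 0, so the right derivative is obtained as the limit
    -- of the derivatives at u > 0.
    · have hr : HasDerivWithinAt (G n) (G (n + 1) 0) (Ici 0) 0 := by
        have hd : ∀ u ∈ Ioi (0 : ℝ), HasDerivAt (fun u ↦ (Q n).1 √u) ((Q (n + 1)).1 √u) u :=
          fun u hu ↦ hasDerivAt_comp_sqrt (Q n).2.1 (hQ n) hu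
        refine HasDerivWithinAt.congr ?_ (hGpos n) (hGpos n self_mem_Ici)
        rw [hGpos (n + 1) self_mem_Ici]
        refine hasDerivWithinAt_Ici_of_tendsto_deriv (s := Ioi 0)
          (fun u hu ↦ (hd u hu).differentiableAt.differentiableWithinAt)
          ((Q n).2.1.continuous.comp Real.continuous_sqrt).continuousWithinAt
          self_mem_nhdsWithin ?_
        have h1 : Tendsto (fun u ↦ (Q (n + 1)).1 √u) (𝓝[>] 0) (𝓝 ((Q (n + 1)).1 √0)) :=
          ((Q (n + 1)).2.1.continuous.comp Real.continuous_sqrt).continuousWithinAt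
        refine h1.congr' ?_
        filter_upwards [self_mem_nhdsWithin] with u hu
        exact (hd u hu).deriv.symm
      have hl : HasDerivWithinAt (G n) (G (n + 1) 0) (Iic 0) 0 := by
        rw [hGneg (n + 1) self_mem_Iic]
        exact (hbd n 0).hasDerivWithinAt.congr (hGneg n) (hGneg n self_mem_Iic)
      simpa [Iic_union_Ici] using hl.union hr
    · rw [hGpos (n + 1) hu.le]
      exact (hasDerivAt_comp_sqrt (Q n).2.1 (hQ n) hu).congr_of_eventuallyEq
        ((hGpos n).eventuallyEq_of_mem (Ici_mem_nhds hu))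
  refine ⟨G 0, ?_, fun s ↦ ?_⟩
  · refine contDiff_infty.2 fun m ↦ ?_
    suffices h : ∀ n, ContDiff ℝ m (G n) from h 0
    induction m with
    | zero =>
      intro n
      rw [Nat.cast_zero, contDiff_zero]
      exact continuous_iff_continuousAt.2 fun u ↦ (hG n u).continuousAt
    | succ m ih =>
      intro n
      rw [Nat.cast_succ]
      refine contDiff_succ_iff_deriv.2 ⟨fun u ↦ (hG n u).differentiableAt, by simp, ?_⟩
      rw [show deriv (G n) = G (n + 1) from funext fun u ↦ (hG n u).deriv]
      exact ih (n + 1)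
  · rw [hGpos 0 (sq_nonneg s)]
    simp only [Real.sqrt_sq_eq_abs, Q, Function.iterate_zero, id]
    rcases abs_choice s with h | h <;> rw [h]
    exact (he s).symm

/-- A smooth function is the sum of a smooth function of `s ^ 2` and `s` times such a function. -/
theorem exists_eq_comp_sq_add_mul_comp_sq {f : ℝ → ℝ} (hf : ContDiff ℝ ∞ f) :
    ∃ g h : ℝ → ℝ, ContDiff ℝ ∞ g ∧ ContDiff ℝ ∞ h ∧ ∀ s, f s = g (s ^ 2) + s * h (s ^ 2) := by
  have hn : ContDiff ℝ ∞ fun s ↦ f (-s) := hf.comp contDiff_neg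
  obtain ⟨g, hg, hfg⟩ := exists_contDiff_eq_comp_sq (f := fun s ↦ (f s + f (-s)) / 2)
    ((hf.add hn).div_const 2) (fun s ↦ by simp only [neg_neg, add_comm])
  have ho : ContDiff ℝ ∞ fun s ↦ (f s - f (-s)) / 2 := (hf.sub hn).div_const 2
  set o : ℝ → ℝ := fun s ↦ (f s - f (-s)) / 2 with ho_def
  have hd := (contDiff_infty_iff_deriv.1 ho).2
  have hde s : deriv o (-s) = deriv o s := by
    have h := deriv_comp_neg (f := o) s
    rw [show (fun x ↦ o (-x)) = -o from funext fun x ↦ by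
      simp only [ho_def, neg_neg, Pi.neg_apply]; ring, deriv.neg] at h
    linarith
  -- The odd part is s times the radial mean of its derivative, and that mean is even.
  obtain ⟨h, hh, hoh⟩ := exists_contDiff_eq_comp_sq (contDiff_radialMean 0 hd) fun s ↦ by
    simp only [radialMean, mul_neg, hde]
  refine ⟨g, h, hg, hh, fun s ↦ ?_⟩
  have h1 := eq_add_smul_radialMean (ho.of_le (m := 1) (by simp)) s
  rw [hoh, smul_eq_mul] at h1
  have h2 := hfg s
  simp only [ho_def, neg_zero, sub_self, zero_div, zero_add] at h1
  linarith

end Even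

/-! ### The inverse function theorem as a local diffeomorphism -/

section InverseFunction

variable {E F : Type*} [NormedAddCommGroup E] [NormedSpace ℝ E] [CompleteSpace E]
  [NormedAddCommGroup F] [NormedSpace ℝ F]

theorem isLocalDiffeomorphAt_of_hasFDerivAt {f : E → F} {f' : E ≃L[ℝ] F} {a : E} {s : Set E}
    (hf : ContDiffOn ℝ ∞ f s) (hs : s ∈ 𝓝 a) (hf' : HasFDerivAt f (f' : E →L[ℝ] F) a) :
    IsLocalDiffeomorphAt 𝓘(ℝ, E) 𝓘(ℝ, F) ∞ f a := by
  have hfi : ContDiffOn ℝ ∞ f (interior s) := hf.mono interior_subset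
  let e := (hf.contDiffAt hs).toOpenPartialHomeomorph f hf' (by simp)
  have hcont : ContinuousOn (fderiv ℝ f) (interior s) :=
    hfi.continuousOn_fderiv_of_isOpen isOpen_interior (by simp)
  -- The inverse must be smooth on a whole neighbourhood, so the domain is cut down to the open set
  -- where the derivative is invertible.
  let V := interior s ∩ fderiv ℝ f ⁻¹' range ((↑) : (E ≃L[ℝ] F) → E →L[ℝ] F)
  have hV : IsOpen V := hcont.isOpen_inter_preimage isOpen_interior
    (ContinuousLinearEquiv.isOpen (𝕜 := ℝ) (E := E) (F := F))
  let e' := e.restrOpen V hV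
  refine ⟨⟨e'.toPartialEquiv, e'.open_source, e'.open_target, ?_, ?_⟩, ?_, fun x _ ↦ rfl⟩
  · exact (hfi.mono fun x hx ↦ hx.2.1).contMDiffOn
  · intro y hy
    have hx : e'.symm y ∈ e'.source := e'.map_target hy
    obtain ⟨f₁, hf₁⟩ := hx.2.2
    have hc : ContDiffAt ℝ ∞ f (e'.symm y) :=
      hfi.contDiffAt (isOpen_interior.mem_nhds hx.2.1)
    have hd : HasFDerivAt f (f₁ : E →L[ℝ] F) (e'.symm y) := by
      rw [hf₁]; exact (hc.differentiableAt (by simp)).hasFDerivAt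
    exact (e'.contDiffAt_symm hy hd hc).contMDiffAt.contMDiffWithinAt
  · refine ⟨(hf.contDiffAt hs).mem_toOpenPartialHomeomorph_source hf' (by simp), ?_, f', ?_⟩
    · exact mem_interior_iff_mem_nhds.2 hs
    · exact hf'.fderiv.symm

theorem isLocalDiffeomorphAt_of_hasDerivAt {f : ℝ → ℝ} {f' a : ℝ} {s : Set ℝ}
    (hf : ContDiffOn ℝ ∞ f s) (hs : s ∈ 𝓝 a) (hf' : HasDerivAt f f' a) (h0 : f' ≠ 0) :
    IsLocalDiffeomorphAt 𝓘(ℝ, ℝ) 𝓘(ℝ, ℝ) ∞ f a :=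
  isLocalDiffeomorphAt_of_hasFDerivAt hf hs (hf'.hasFDerivAt_equiv h0)

end InverseFunction

/-! ### Normal form of a plane cusp -/

section NormalForm

/-- The coordinates of a vector with respect to two linearly independent vectors of the plane. -/
noncomputable def planeBasisEquiv (p q : Plane) (h : p 0 * q 1 - p 1 * q 0 ≠ 0) :
    Plane ≃L[ℝ] Plane :=
  have h' := inv_mul_cancel₀ h
  LinearEquiv.toContinuousLinearEquiv
    { toFun := fun v ↦ !₂[(p 0 * q 1 - p 1 * q 0)⁻¹ * (v 0 * q 1 - v 1 * q 0),
        (p 0 * q 1 - p 1 * q 0)⁻¹ * (p 0 * v 1 - p 1 * v 0)]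
      invFun := fun c ↦ c 0 • p + c 1 • q
      map_add' := fun v w ↦ by ext i; fin_cases i <;> simp <;> ring
      map_smul' := fun c v ↦ by ext i; fin_cases i <;> simp <;> ring
      left_inv := fun v ↦ by
        ext i; fin_cases i <;> simp
        · linear_combination v 0 * h'
        · linear_combination v 1 * h'
      right_inv := fun v ↦ by
        ext i; fin_cases i <;> simp
        · linear_combination v 0 * h'
        · linear_combination v 1 * h' }

theorem planeBasisEquiv_left (p q : Plane) (h : p 0 * q 1 - p 1 * q 0 ≠ 0) :
    planeBasisEquiv p q h p = !₂[1, 0] := by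
  have h' := inv_mul_cancel₀ h
  ext i; fin_cases i
  · exact h'
  · change (p 0 * q 1 - p 1 * q 0)⁻¹ * (p 0 * p 1 - p 1 * p 0) = 0
    ring

theorem planeBasisEquiv_right (p q : Plane) (h : p 0 * q 1 - p 1 * q 0 ≠ 0) :
    planeBasisEquiv p q h q = !₂[0, 1] := by
  have h' := inv_mul_cancel₀ h
  ext i; fin_cases i
  · change (p 0 * q 1 - p 1 * q 0)⁻¹ * (q 0 * q 1 - q 1 * q 0) = 0
    ring
  · exact h'

/-- The inverse of a local coordinate change of the line at `0`, extended to a global function. -/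
theorem exists_contDiff_local_inverse {θ : ℝ → ℝ}
    (h : IsLocalDiffeomorphAt 𝓘(ℝ, ℝ) 𝓘(ℝ, ℝ) ∞ θ 0) (h0 : θ 0 = 0) :
    ∃ σ : ℝ → ℝ, ContDiff ℝ ∞ σ ∧ σ 0 = 0 ∧ IsLocalDiffeomorphAt 𝓘(ℝ, ℝ) 𝓘(ℝ, ℝ) ∞ σ 0 ∧
      (∀ᶠ s in 𝓝 0, θ (σ s) = s) ∧ ∀ᶠ t in 𝓝 0, σ (θ t) = t := by
  have hmem := h.localInverse_mem_source
  obtain ⟨σ, hσ, he⟩ := exists_contDiff_eventuallyEq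
    (contMDiffOn_iff_contDiffOn.1 h.localInverse_contMDiffOn)
    (h.localInverse_open_source.mem_nhds hmem)
  rw [h0] at he
  have hl := h.localInverse_eventuallyEq_left
  have hr := h.localInverse_eventuallyEq_right
  rw [h0] at hr
  have hc : Tendsto θ (𝓝 0) (𝓝 0) := by
    have := h.contMDiffAt.continuousAt.tendsto
    rwa [h0] at this
  have hl' : ∀ᶠ t in 𝓝 0, σ (θ t) = t := by
    filter_upwards [hc.eventually he, hl] with t h1 h2
    rw [h1]; exact h2
  have hr' : ∀ᶠ s in 𝓝 0, θ (σ s) = s := by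
    filter_upwards [he, hr] with t h1 h2
    rw [h1]; exact h2
  have hσ0 : σ 0 = 0 := by simpa [h0] using hl'.self_of_nhds
  refine ⟨σ, hσ, hσ0, ?_, hr', hl'⟩
  have hd : HasDerivAt σ (deriv σ 0) 0 := (hσ.differentiable (by simp) 0).hasDerivAt
  refine isLocalDiffeomorphAt_of_hasDerivAt hσ.contDiffOn univ_mem hd fun hz ↦ ?_
  have hθ : HasDerivAt θ (deriv θ 0) (σ 0) := by
    rw [hσ0]
    exact ((contMDiffAt_iff_contDiffAt.1 h.contMDiffAt).differentiableAt (by simp)).hasDerivAt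
  have h1 := (hθ.comp 0 hd).congr_of_eventuallyEq (f₁ := id)
    (by filter_upwards [hr'] with s hs using hs.symm)
  have h2 := h1.unique (hasDerivAt_id 0)
  rw [hz] at h2
  simp at h2

/-- A smooth plane curve `x₀ + t² A(t)` with `A(0)`, `A'(0)` linearly independent is a 3/2-cusp. -/
theorem exists_cusp_normal_form {x : ℝ → Plane} {x₀ : Plane} {A : ℝ → Plane}
    (hA : ContDiff ℝ ∞ A) (hx : ∀ᶠ t in 𝓝 0, x t = x₀ + t ^ 2 • A t)
    (hdet : A 0 0 * deriv A 0 1 - A 0 1 * deriv A 0 0 ≠ 0) :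
    ∃ (Φ : Plane → Plane) (σ : ℝ → ℝ), IsLocalDiffeomorphAt (𝓡 2) (𝓡 2) ∞ Φ x₀ ∧
      IsLocalDiffeomorphAt 𝓘(ℝ, ℝ) 𝓘(ℝ, ℝ) ∞ σ 0 ∧ σ 0 = 0 ∧
      ∀ᶠ s in 𝓝 (0 : ℝ), Φ (x (σ s)) = !₂[s ^ 2, s ^ 3] := by
  -- In the basis A(0), A'(0) the curve is t² (a, c) with a(0) = 1, c(0) = 0 and c'(0) = 1.
  set L := planeBasisEquiv (A 0) (deriv A 0) hdet with hL
  have hLA : ContDiff ℝ ∞ fun t ↦ L (A t) := L.contDiff.comp hA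
  have hLA' : HasDerivAt (fun t ↦ L (A t)) !₂[0, 1] 0 := by
    rw [← planeBasisEquiv_right _ _ hdet]
    exact (L : Plane →L[ℝ] Plane).hasFDerivAt.comp_hasDerivAt 0
      (hA.differentiable (by simp) 0).hasDerivAt
  have hLA0 : L (A 0) = !₂[1, 0] := planeBasisEquiv_left _ _ hdet
  let a : ℝ → ℝ := fun t ↦ L (A t) 0
  let c : ℝ → ℝ := fun t ↦ L (A t) 1
  have ha : ContDiff ℝ ∞ a := contDiff_euclidean.1 hLA 0
  have hc : ContDiff ℝ ∞ c := contDiff_euclidean.1 hLA 1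
  have ha0 : a 0 = 1 := by simp [a, hLA0]
  have hc0 : c 0 = 0 := by simp [c, hLA0]
  have hc1 : deriv c 0 = 1 := by
    have : HasDerivAt c ((!₂[0, 1] : Plane) 1) 0 :=
      (EuclideanSpace.proj (𝕜 := ℝ) (1 : Fin 2)).hasFDerivAt.comp_hasDerivAt 0 hLA'
    simpa using this.deriv
  let b := radialMean 0 (deriv c)
  have hb : ContDiff ℝ ∞ b := contDiff_radialMean 0 (contDiff_infty_iff_deriv.1 hc).2
  have hb0 : b 0 = 1 := by simp [b, radialMean_zero, hc1]
  have hcb t : c t = t * b t := by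
    have := eq_add_smul_radialMean (hc.of_le (m := 1) (by simp)) t
    rwa [hc0, zero_add, smul_eq_mul] at this
  let U := {t | 0 < a t}
  have hU : U ∈ 𝓝 (0 : ℝ) := (isOpen_lt continuous_const ha.continuous).mem_nhds (by simp [ha0])
  -- The new parameter is the signed square root of the first coordinate t² a(t).
  let θ : ℝ → ℝ := fun t ↦ t * √(a t)
  have hsq : ContDiffOn ℝ ∞ (fun t ↦ √(a t)) U := ha.contDiffOn.sqrt fun t ht ↦ (ne_of_gt ht)
  have hθ : ContDiffOn ℝ ∞ θ U := contDiffOn_id.mul hsq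
  have hθ1 : HasDerivAt θ 1 0 := by
    have := (hasDerivAt_id' (0 : ℝ)).fun_mul
      ((hsq.contDiffAt hU).differentiableAt (by simp)).hasDerivAt
    simpa [ha0] using this
  have hθ0 : θ 0 = 0 := by simp [θ]
  obtain ⟨σ, hσ, hσ0, hσl, hθσ, -⟩ := exists_contDiff_local_inverse
    (isLocalDiffeomorphAt_of_hasDerivAt hθ hU hθ1 one_ne_zero) hθ0
  have hσ1 : deriv σ 0 = 1 := by
    have hd : HasDerivAt σ (deriv σ 0) 0 := (hσ.differentiable (by simp) 0).hasDerivAt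
    have h1 := (hσ0.symm ▸ hθ1 : HasDerivAt θ 1 (σ 0)).comp 0 hd
    have h2 := h1.congr_of_eventuallyEq (f₁ := id)
      (by filter_upwards [hθσ] with s hs using hs.symm)
    simpa using h2.unique (hasDerivAt_id 0)
  let r := radialMean 0 (deriv σ)
  have hr : ContDiff ℝ ∞ r := contDiff_radialMean 0 (contDiff_infty_iff_deriv.1 hσ).2
  have hr0 : r 0 = 1 := by simp [r, radialMean_zero, hσ1]
  have hσr s : σ s = s * r s := by
    have := eq_add_smul_radialMean (hσ.of_le (m := 1) (by simp)) s
    rwa [hσ0, zero_add, smul_eq_mul] at this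
  -- The second coordinate is s³ g(s²) + (s²)² h(s²): its even part depends on the first coordinate
  -- u = s² alone and can be subtracted, and dividing by g(u) then leaves s³.
  obtain ⟨g, h, hg, hh, hgh⟩ := exists_eq_comp_sq_add_mul_comp_sq
    (f := fun s ↦ b (σ s) * r s ^ 3) ((hb.comp hσ).mul (hr.pow 3))
  have hg0 : g 0 = 1 := by simpa [hσ0, hb0, hr0] using (hgh 0).symm
  let u : Plane → ℝ := fun y ↦ L (y - x₀) 0
  let w : Plane → ℝ := fun y ↦ L (y - x₀) 1
  have hL' : ContDiff ℝ ∞ fun y ↦ L (y - x₀) := L.contDiff.comp (contDiff_id.sub contDiff_const)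
  have hu : ContDiff ℝ ∞ u := contDiff_euclidean.1 hL' 0
  have hw : ContDiff ℝ ∞ w := contDiff_euclidean.1 hL' 1
  have hu0 : u x₀ = 0 := by simp [u]
  have hw0 : w x₀ = 0 := by simp [w]
  have hLd (i : Fin 2) : HasFDerivAt (fun y ↦ L (y - x₀) i)
      ((EuclideanSpace.proj (𝕜 := ℝ) i).comp (L : Plane →L[ℝ] Plane)) x₀ :=
    ((EuclideanSpace.proj (𝕜 := ℝ) i).comp (L : Plane →L[ℝ] Plane)).hasFDerivAt.comp x₀
      ((hasFDerivAt_id x₀).sub_const x₀)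
  let Φ : Plane → Plane := fun y ↦ !₂[u y, (w y - u y * (u y * h (u y))) * (g (u y))⁻¹]
  let V := {y | g (u y) ≠ 0}
  have hV : V ∈ 𝓝 x₀ := (isOpen_ne_fun (hg.continuous.comp hu.continuous)
    continuous_const).mem_nhds (by simp [hu0, hg0])
  have hgi : ContDiffOn ℝ ∞ (fun y ↦ (g (u y))⁻¹) V :=
    (hg.comp hu).contDiffOn.inv fun y hy ↦ hy
  have hΦ : ContDiffOn ℝ ∞ Φ V := by
    refine contDiffOn_euclidean.2 fun i ↦ ?_
    fin_cases i
    · exact hu.contDiffOn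
    · exact (hw.sub (hu.mul (hu.mul (hh.comp hu)))).contDiffOn.mul hgi
  have hΦ' : HasFDerivAt Φ (L : Plane →L[ℝ] Plane) x₀ := by
    rw [← hasFDerivWithinAt_univ, hasFDerivWithinAt_euclidean]
    intro i
    rw [hasFDerivWithinAt_univ]
    fin_cases i
    · exact hLd 0
    · have h1 := (((hLd 1).fun_sub ((hLd 0).fun_mul ((hLd 0).fun_mul
        ((hh.comp hu).differentiable (by simp) x₀).hasFDerivAt)))).fun_mul
        ((hgi.contDiffAt hV).differentiableAt (by simp)).hasFDerivAt
      refine h1.congr_fderiv ?_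
      ext v
      simp [hu0, hg0]
  refine ⟨Φ, σ, isLocalDiffeomorphAt_of_hasFDerivAt hΦ hV hΦ', hσl, hσ0, ?_⟩
  have hσt : Tendsto σ (𝓝 0) (𝓝 0) := by simpa [hσ0] using hσ.continuous.tendsto 0
  have hg' : ∀ᶠ s in 𝓝 (0 : ℝ), g (s ^ 2) ≠ 0 := by
    have : Continuous fun s : ℝ ↦ g (s ^ 2) := hg.continuous.comp (continuous_pow 2)
    exact (isOpen_ne_fun this continuous_const).mem_nhds (by simp [hg0])
  filter_upwards [hσt.eventually hx, hθσ, hσt.eventually hU, hg'] with s h1 h2 h3 h4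
  have hLx : L (x (σ s) - x₀) = σ s ^ 2 • L (A (σ s)) := by rw [h1]; simp
  have hus : u (x (σ s)) = s ^ 2 := by
    simp only [u, hLx]
    change σ s ^ 2 * a (σ s) = s ^ 2
    have h5 : √(a (σ s)) ^ 2 = a (σ s) := Real.sq_sqrt (le_of_lt h3)
    rw [← h5, ← mul_pow]
    exact congrArg (· ^ 2) h2
  have hws : w (x (σ s)) = s ^ 3 * (g (s ^ 2) + s * h (s ^ 2)) := by
    simp only [w, hLx]
    change σ s ^ 2 * c (σ s) = _
    rw [hcb, ← hgh, hσr]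
    ring
  simp only [Φ, hus, hws]
  have : (s ^ 3 * (g (s ^ 2) + s * h (s ^ 2)) - s ^ 2 * (s ^ 2 * h (s ^ 2))) * (g (s ^ 2))⁻¹ =
      s ^ 3 := by
    field_simp
    ring
  rw [this]

end NormalForm

/-! ### Cusps in terms of the derivative of the coordinates -/

section CuspInChart

variable {M : Type*} [TopologicalSpace M] [ChartedSpace Plane M] [IsManifold (𝓡 2) ∞ M]

theorem isLocalDiffeomorphAt_extChartAt (p : M) :
    IsLocalDiffeomorphAt (𝓡 2) (𝓡 2) ∞ (extChartAt (𝓡 2) p) p := by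
  refine ⟨⟨extChartAt (𝓡 2) p, isOpen_extChartAt_source p, isOpen_extChartAt_target p, ?_, ?_⟩,
    mem_extChartAt_source p, fun _ _ ↦ rfl⟩
  · rw [extChartAt_source]
    exact contMDiffOn_extChartAt (I := 𝓡 2) (n := ∞) (x := p)
  · exact contMDiffOn_extChartAt_symm p

/-- The curve `γ` in the coordinates of the preferred chart at `p`. -/
noncomputable def chartCurve (p : M) (γ : ℝ → M) (t : ℝ) : Plane := extChartAt (𝓡 2) p (γ t)

/-- A curve whose coordinates have derivative `t w(t)`, with `w(0)` and `w'(0)` linearly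
independent, has a 3/2-cusp. -/
theorem isThreeHalvesCusp_of_deriv_eq {γ : ℝ → M} {w : ℝ → Plane} (hw : ContDiff ℝ ∞ w)
    (hx : ∀ᶠ t in 𝓝 0, HasDerivAt (chartCurve (γ 0) γ) (t • w t) t)
    (hdet : w 0 0 * deriv w 0 1 - w 0 1 * deriv w 0 0 ≠ 0) : IsThreeHalvesCusp γ := by
  -- Integrating t w(t) gives x - x₀ = t² A, with A(0) = w(0) / 2 and A'(0) = w'(0) / 3.
  let A := radialMean 1 w
  have hA : ContDiff ℝ ∞ A := contDiff_radialMean 1 hw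
  have hA0 : A 0 = (2⁻¹ : ℝ) • w 0 := by
    change radialMean 1 w 0 = _
    rw [radialMean_zero]; norm_num
  have hA1 : deriv A 0 = (3⁻¹ : ℝ) • deriv w 0 := by
    have h1 := (hasDerivAt_radialMean 1 (hw.of_le (m := 1) (by simp)) 0).deriv
    rw [h1, radialMean_zero]; norm_num
  obtain ⟨Φ, σ, hΦ, hσ, hσ0, h⟩ := exists_cusp_normal_form (x := chartCurve (γ 0) γ)
    (x₀ := chartCurve (γ 0) γ 0) hA (by
      obtain ⟨ε, hε, h⟩ := Metric.eventually_nhds_iff.1 hx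
      refine Metric.eventually_nhds_iff.2 ⟨ε, hε, fun t ht ↦ ?_⟩
      have h1 : ∫ u in (0 : ℝ)..t, u • w u = chartCurve (γ 0) γ t - chartCurve (γ 0) γ 0 := by
        refine intervalIntegral.integral_eq_sub_of_hasDerivAt (fun u hu ↦ h ?_)
          ((continuous_id.smul hw.continuous).intervalIntegrable _ _)
        rw [Real.dist_eq, sub_zero] at ht ⊢
        have h2 := Set.abs_sub_left_of_mem_uIcc hu
        rw [sub_zero, sub_zero] at h2
        exact h2.trans_lt ht
      have h2 := intervalIntegral_pow_smul_eq_radialMean 1 w t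
      simp only [pow_one] at h2
      rw [h1] at h2
      rw [← h2]
      abel) (by
      rw [hA0, hA1]
      simp only [PiLp.smul_apply, smul_eq_mul]
      intro h
      apply hdet
      linarith)
  refine ⟨Φ ∘ extChartAt (𝓡 2) (γ 0), σ, ?_, hσ, hσ0, h⟩
  exact (isLocalDiffeomorphAt_extChartAt (γ 0)).comp (𝓡 2) Plane hΦ

/-- At a 3/2-cusp the derivative of the coordinates is `t w(t)` with `w` smooth and `w(0) ≠ 0`. -/
theorem IsThreeHalvesCusp.exists_deriv_eq {γ : ℝ → M} (h : IsThreeHalvesCusp γ)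
    (hγ : ContinuousAt γ 0) {x : ℝ → Plane} (hx : ContDiff ℝ ∞ x)
    (hxγ : x =ᶠ[𝓝 0] chartCurve (γ 0) γ) :
    ∃ w : ℝ → Plane, ContDiff ℝ ∞ w ∧ w 0 ≠ 0 ∧ ∀ t, deriv x t = t • w t := by
  obtain ⟨Φ, σ, hΦ, hσ, hσ0, hc⟩ := h
  obtain ⟨θ, hθ, hθ0, hθl, hσθ, hθσ⟩ := exists_contDiff_local_inverse hσ hσ0
  have hθ' : HasDerivAt θ (deriv θ 0) 0 := (hθ.differentiable (by simp) 0).hasDerivAt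
  have hθ1 : deriv θ 0 ≠ 0 := by
    intro h0
    have hσd : HasDerivAt σ (deriv σ 0) (θ 0) := by
      rw [hθ0]
      exact ((contMDiffAt_iff_contDiffAt.1 hσ.contMDiffAt).differentiableAt (by simp)).hasDerivAt
    have h1 := (hσd.comp 0 hθ').congr_of_eventuallyEq (f₁ := id)
      (by filter_upwards [hσθ] with s hs using hs.symm)
    have h2 := h1.unique (hasDerivAt_id 0)
    rw [h0] at h2
    simp at h2
  have hθt : Tendsto θ (𝓝 0) (𝓝 0) := by simpa [hθ0] using hθ.continuous.tendsto 0
  have hcθ : ∀ᶠ t in 𝓝 0, Φ (γ t) = !₂[θ t ^ 2, θ t ^ 3] := by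
    filter_upwards [hθt.eventually hc, hσθ] with t h1 h2
    rwa [h2] at h1
  have hl := isLocalDiffeomorphAt_extChartAt (γ 0)
  have hx0 : x 0 = extChartAt (𝓡 2) (γ 0) (γ 0) := hxγ.self_of_nhds
  have hli := hl.localInverse_left_inv hl.localInverse_mem_target
  -- the composition of `Φ` with the inverse chart
  have hF : IsLocalDiffeomorphAt (𝓡 2) (𝓡 2) ∞ (Φ ∘ hl.localInverse) (x 0) := by
    rw [hx0]
    exact hl.localInverse_isLocalDiffeomorphAt.comp (𝓡 2) Plane (by rwa [hli])
  set F := Φ ∘ hl.localInverse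
  have hFx : ∀ᶠ t in 𝓝 0, F (x t) = !₂[θ t ^ 2, θ t ^ 3] := by
    filter_upwards [hcθ, hxγ, hγ.eventually hl.localInverse_eventuallyEq_left] with t h1 h2 h3
    rw [← h1, h2]
    exact congrArg Φ h3
  have hxt : Tendsto x (𝓝 0) (𝓝 (x 0)) := hx.continuous.tendsto 0
  have hx' : HasDerivAt x (deriv x 0) 0 := (hx.differentiable (by simp) 0).hasDerivAt
  -- Near 0 the curve x is a differentiable local inverse of `F` applied to (θ², θ³), whose
  -- derivative vanishes at 0.
  have hd0 : deriv x 0 = 0 := by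
    have hF0 : F (x 0) = !₂[θ 0 ^ 2, θ 0 ^ 3] := hFx.self_of_nhds
    have hG := (contMDiffAt_iff_contDiffAt.1 hF.localInverse_contMDiffAt).differentiableAt
      (by simp)
    rw [hF0] at hG
    have hcd : HasDerivAt (fun t ↦ (!₂[θ t ^ 2, θ t ^ 3] : Plane)) 0 0 := by
      rw [hasDerivAt_iff_hasFDerivAt, ← hasFDerivWithinAt_univ, hasFDerivWithinAt_euclidean]
      intro i
      rw [hasFDerivWithinAt_univ]
      fin_cases i
      · exact (hθ'.fun_pow 2).hasFDerivAt.congr_fderiv (by ext; simp [hθ0])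
      · exact (hθ'.fun_pow 3).hasFDerivAt.congr_fderiv (by ext; simp [hθ0])
    have h1 := hG.hasFDerivAt.comp_hasDerivAt 0 hcd
    rw [map_zero] at h1
    refine hx'.unique (h1.congr_of_eventuallyEq ?_)
    filter_upwards [hFx, hxt.eventually hF.localInverse_eventuallyEq_left] with t h2 h3
    rw [Function.comp_apply, ← h2]
    exact h3.symm
  have hxx := (contDiff_infty_iff_deriv.1 (contDiff_infty_iff_deriv.1 hx).2).2
  have hw := contDiff_radialMean 0 hxx
  have hwx t : deriv x t = t • radialMean 0 (deriv (deriv x)) t := by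
    have := eq_add_smul_radialMean ((contDiff_infty_iff_deriv.1 hx).2.of_le (m := 1) (by simp)) t
    rwa [hd0, zero_add] at this
  -- If w(0) = 0, then x - x(0) = o(t²), hence also F(x) - F(x(0)) = o(t²). But its first coordinate
  -- is θ² = t² ρ² with ρ(0) = θ'(0) ≠ 0.
  refine ⟨_, hw, fun hw0 ↦ ?_, hwx⟩
  set w := radialMean 0 (deriv (deriv x))
  let A := radialMean 1 w
  have hA : ContDiff ℝ ∞ A := contDiff_radialMean 1 hw
  have hA0 : A 0 = 0 := by
    change radialMean 1 w 0 = 0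
    rw [radialMean_zero, hw0, smul_zero]
  have hxA t : x t - x 0 = t ^ 2 • A t := by
    have h2 := intervalIntegral_pow_smul_eq_radialMean 1 w t
    simp only [pow_one, ← hwx] at h2
    rw [← h2, intervalIntegral.integral_deriv_eq_sub' _ rfl
      (fun y _ ↦ hx.differentiable (by simp) y)
      (contDiff_infty_iff_deriv.1 hx).2.continuous.continuousOn]
  have hFd := (contMDiffAt_iff_contDiffAt.1 hF.contMDiffAt).differentiableAt (by simp)
  obtain ⟨C, hC⟩ := hFd.isBigO_sub.bound
  have hρ t := eq_add_smul_radialMean (hθ.of_le (m := 1) (by simp)) t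
  have hρc := (contDiff_radialMean 0 (contDiff_infty_iff_deriv.1 hθ).2).continuous
  have hρ0 : radialMean 0 (deriv θ) 0 = deriv θ 0 := by simp [radialMean_zero]
  set ρ := radialMean 0 (deriv θ)
  have hle : ∀ᶠ t in 𝓝[≠] (0 : ℝ), ρ t ^ 2 ≤ C * ‖A t‖ := by
    filter_upwards [(hxt.eventually hC).filter_mono nhdsWithin_le_nhds,
      hFx.filter_mono nhdsWithin_le_nhds, self_mem_nhdsWithin] with t h1 h2 h3
    have hF0 : F (x 0) = !₂[θ 0 ^ 2, θ 0 ^ 3] := hFx.self_of_nhds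
    rw [h2, hF0, hxA, norm_smul] at h1
    have h4 := (PiLp.norm_apply_le (!₂[θ t ^ 2, θ t ^ 3] - !₂[θ 0 ^ 2, θ 0 ^ 3] : Plane) 0).trans h1
    have h5 := hρ t
    rw [hθ0, zero_add, smul_eq_mul] at h5
    have h6 : |θ t ^ 2| ≤ C * (t ^ 2 * ‖A t‖) := by simpa [hθ0] using h4
    rw [abs_of_nonneg (sq_nonneg _), h5] at h6
    have h7 : 0 < t ^ 2 := by have : t ≠ 0 := h3; positivity
    refine le_of_mul_le_mul_left ?_ h7
    linarith
  have hlim1 : Tendsto (fun t ↦ ρ t ^ 2) (𝓝[≠] 0) (𝓝 (ρ 0 ^ 2)) :=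
    ((hρc.pow 2).tendsto 0).mono_left nhdsWithin_le_nhds
  have hlim2 : Tendsto (fun t ↦ C * ‖A t‖) (𝓝[≠] 0) (𝓝 (C * ‖A 0‖)) :=
    ((continuous_const.mul hA.continuous.norm).tendsto 0).mono_left nhdsWithin_le_nhds
  have := le_of_tendsto_of_tendsto hlim1 hlim2 hle
  rw [hA0, norm_zero, mul_zero, hρ0] at this
  exact hθ1 (pow_eq_zero_iff two_ne_zero |>.1 (le_antisymm this (sq_nonneg _)))

end CuspInChart

/-! ### The normed space of bilinear forms -/

section BilinForm

/-- A continuous bilinear form on a normed space. -/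
abbrev BilinForm (E : Type*) [NormedAddCommGroup E] [NormedSpace ℝ E] : Type _ :=
  E →L[ℝ] E →L[ℝ] ℝ

variable {E : Type*} [NormedAddCommGroup E] [NormedSpace ℝ E]

noncomputable instance : NormedAddCommGroup (BilinForm E) :=
  ContinuousLinearMap.toNormedAddCommGroup

noncomputable instance : SeminormedAddCommGroup (BilinForm E) :=
  NormedAddCommGroup.toSeminormedAddCommGroup

noncomputable instance : NormedSpace ℝ (BilinForm E) := ContinuousLinearMap.toNormedSpace

instance : IsBoundedSMul ℝ (BilinForm E) := NormedSpace.toIsBoundedSMul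

end BilinForm

/-! ### The metric and the Christoffel symbols in a chart -/

section Metric

variable {M : Type*} [TopologicalSpace M] [ChartedSpace Plane M] [IsManifold (𝓡 2) ∞ M]

/-- The components of a tangent vector at `q` in the chart at `p`. -/
noncomputable abbrev components (p : M) {q : M} (v : TangentSpace (𝓡 2) q) : Plane :=
  (chartTriv p).continuousLinearMapAt ℝ q v

theorem symmL_components {p q : M} (hq : q ∈ (chartAt Plane p).source)
    (v : TangentSpace (𝓡 2) q) : (chartTriv p).symmL ℝ q (components p v) = v :=
  (chartTriv p).symmL_continuousLinearMapAt hq v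

theorem components_symmL {p q : M} (hq : q ∈ (chartAt Plane p).source) (c : Plane) :
    components p ((chartTriv p).symmL ℝ q c) = c :=
  (chartTriv p).continuousLinearMapAt_symmL hq c

theorem symmL_eq_sum (p q : M) (c : Plane) :
    (chartTriv p).symmL ℝ q c = ∑ i, c i • coordVec p q i := by
  have h : c = ∑ i, c i • EuclideanSpace.single i (1 : ℝ) := by
    ext i; fin_cases i <;> simp
  conv_lhs => rw [h]
  simp only [map_sum, map_smul, coordVec]

theorem contMDiffOn_coordVec (p : M) (i : Fin 2) :
    ContMDiffOn (𝓡 2) ((𝓡 2).prod 𝓘(ℝ, Plane)) ∞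
      (fun q ↦ (⟨q, coordVec p q i⟩ : TangentBundle (𝓡 2) M)) (chartAt Plane p).source := by
  have h1 := (chartTriv p).contMDiffOn_symm (IB := 𝓡 2) (n := ∞)
  have h2 : ContMDiffOn (𝓡 2) ((𝓡 2).prod 𝓘(ℝ, Plane)) ∞
      (fun q : M ↦ (q, EuclideanSpace.single i (1 : ℝ))) (chartAt Plane p).source :=
    contMDiffOn_id.prodMk contMDiffOn_const
  refine (h1.comp h2 fun q hq ↦ ?_).congr fun q hq ↦ ?_
  · exact ⟨hq, mem_univ _⟩
  · rw [coordVec, Trivialization.symmL_apply _ hq]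
    exact (chartTriv p).mk_symm hq _

variable [RiemannianBundle (fun p : M ↦ TangentSpace (𝓡 2) p)]

theorem metricMatrix_extChartAt {p q : M} (hq : q ∈ (chartAt Plane p).source) (i j : Fin 2) :
    metricMatrix p (extChartAt (𝓡 2) p q) i j = inner ℝ (coordVec p q i) (coordVec p q j) := by
  have h : ∀ q' : M, q' = q → inner ℝ (coordVec p q' i) (coordVec p q' j) =
      inner ℝ (coordVec p q i) (coordVec p q j) := by rintro _ rfl; rfl
  exact h _ ((extChartAt (𝓡 2) p).left_inv (by rwa [extChartAt_source]))

theorem metricMatrix_symm (p : M) (y : Plane) (i j : Fin 2) :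
    metricMatrix p y i j = metricMatrix p y j i :=
  real_inner_comm (coordVec p _ j) (coordVec p _ i)

/-- The metric in the coordinates of the chart at `p`, as a bilinear form on the plane. -/
noncomputable def metricForm (p : M) (y : Plane) : BilinForm Plane :=
  ∑ i, ∑ j, metricMatrix p y i j •
    (EuclideanSpace.proj (𝕜 := ℝ) i : Plane →L[ℝ] ℝ).smulRight
      (EuclideanSpace.proj (𝕜 := ℝ) j : Plane →L[ℝ] ℝ)

theorem metricForm_apply (p : M) (y v w : Plane) :
    metricForm p y v w = ∑ i, ∑ j, metricMatrix p y i j * (v i * w j) := by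
  simp [metricForm]

theorem metricForm_symm (p : M) (y v w : Plane) : metricForm p y v w = metricForm p y w v := by
  simp only [metricForm_apply, Fin.sum_univ_two, metricMatrix_symm p y 1 0]
  ring

theorem metricForm_components {p q : M} (hq : q ∈ (chartAt Plane p).source)
    (v w : TangentSpace (𝓡 2) q) :
    metricForm p (extChartAt (𝓡 2) p q) (components p v) (components p w) = inner ℝ v w := by
  conv_rhs => rw [← symmL_components hq v, ← symmL_components hq w, symmL_eq_sum, symmL_eq_sum]
  rw [metricForm_apply, sum_inner]
  refine Finset.sum_congr rfl fun i _ ↦ ?_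
  rw [inner_sum]
  refine Finset.sum_congr rfl fun j _ ↦ ?_
  rw [metricMatrix_extChartAt hq, real_inner_smul_left, real_inner_smul_right]
  ring

theorem metricForm_self_components {p q : M} (hq : q ∈ (chartAt Plane p).source)
    (v : TangentSpace (𝓡 2) q) :
    metricForm p (extChartAt (𝓡 2) p q) (components p v) (components p v) = ‖v‖ ^ 2 := by
  rw [metricForm_components hq, real_inner_self_eq_norm_sq]

theorem metricForm_self_pos {p : M} {y : Plane} (hy : y ∈ (extChartAt (𝓡 2) p).target) {v : Plane}
    (hv : v ≠ 0) : 0 < metricForm p y v v := by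
  have hq : (extChartAt (𝓡 2) p).symm y ∈ (chartAt Plane p).source := by
    rw [← extChartAt_source (𝓡 2) p]
    exact (extChartAt (𝓡 2) p).map_target hy
  have h := metricForm_self_components hq ((chartTriv p).symmL ℝ _ v)
  rw [components_symmL hq, (extChartAt (𝓡 2) p).right_inv hy] at h
  rw [h]
  refine pow_pos (norm_pos_iff.2 fun h0 ↦ hv ?_) 2
  rw [← components_symmL hq v, h0]
  exact map_zero ((chartTriv p).continuousLinearMapAt ℝ _)

theorem det_metricMatrix (p : M) (y : Plane) : (metricMatrix p y).det =
    metricMatrix p y 0 0 * metricMatrix p y 1 1 - metricMatrix p y 0 1 ^ 2 := by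
  rw [Matrix.det_fin_two, metricMatrix_symm p y 1 0]
  ring

/-- The vector (1, 0) gives g₀₀ > 0, and the vector (-g₀₁, g₀₀) has squared length g₀₀ det g. -/
theorem det_metricMatrix_pos {p : M} {y : Plane} (hy : y ∈ (extChartAt (𝓡 2) p).target) :
    0 < (metricMatrix p y).det := by
  have h0 := metricForm_self_pos hy (v := !₂[1, 0]) fun h ↦ by
    have := congrArg (· 0) h
    simp at this
  simp [metricForm_apply] at h0
  have h1 := metricForm_self_pos hy (v := !₂[-metricMatrix p y 0 1, metricMatrix p y 0 0])
    fun h ↦ by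
      have := congrArg (· 1) h
      simp at this
      exact h0.ne' this
  simp [metricForm_apply, metricMatrix_symm p y 1 0] at h1
  rw [det_metricMatrix]
  refine pos_of_mul_pos_right ?_ h0.le
  linarith

theorem metricForm_ext {p : M} {y : Plane} (hy : y ∈ (extChartAt (𝓡 2) p).target) {u v : Plane}
    (h : ∀ w, metricForm p y u w = metricForm p y v w) : u = v := by
  by_contra huv
  have h1 := metricForm_self_pos hy (sub_ne_zero.2 huv)
  rw [map_sub (metricForm p y), sub_apply, h, sub_self] at h1
  exact lt_irrefl _ h1

/-- The vector with components `∑ i j, Γᵏ_ij uⁱ vʲ`. -/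
noncomputable def christoffelVec (p : M) (y u v : Plane) : Plane :=
  WithLp.toLp 2 fun k ↦ ∑ i, ∑ j, christoffel p y k i j * u i * v j

theorem covDerivComponents_eq (p : M) (γ : ℝ → M) (X : ∀ t, TangentSpace (𝓡 2) (γ t)) (t : ℝ) :
    covDerivComponents p γ X t = deriv (fun s ↦ components p (X s)) t +
      christoffelVec p (chartCurve p γ t) (deriv (chartCurve p γ) t) (components p (X t)) :=
  rfl

theorem christoffelVec_smul_smul (p : M) (y u v : Plane) (a b : ℝ) :
    christoffelVec p y (a • u) (b • v) = (a * b) • christoffelVec p y u v := by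
  ext k
  simp only [christoffelVec, Fin.sum_univ_two, PiLp.smul_apply, smul_eq_mul]
  ring

theorem christoffelVec_zero_left (p : M) (y v : Plane) : christoffelVec p y 0 v = 0 := by
  ext k
  simp [christoffelVec]

section Smooth

variable [IsContMDiffRiemannianBundle (𝓡 2) ∞ Plane (fun p : M ↦ TangentSpace (𝓡 2) p)]

theorem contDiffOn_metricMatrix (p : M) (i j : Fin 2) :
    ContDiffOn ℝ ∞ (fun y ↦ metricMatrix p y i j) (extChartAt (𝓡 2) p).target := by
  rw [← contMDiffOn_iff_contDiffOn]
  have h1 := (contMDiffOn_coordVec p i).inner_bundle (contMDiffOn_coordVec p j)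
  refine h1.comp (contMDiffOn_extChartAt_symm (I := 𝓡 2) (n := ∞) p) fun y hy ↦ ?_
  rw [← extChartAt_source (𝓡 2) p]
  exact (extChartAt (𝓡 2) p).map_target hy

theorem contDiffOn_metricForm (p : M) :
    ContDiffOn ℝ ∞ (metricForm p) (extChartAt (𝓡 2) p).target :=
  ContDiffOn.sum fun i _ ↦ ContDiffOn.sum fun j _ ↦
    (contDiffOn_metricMatrix p i j).smul contDiffOn_const

theorem contDiffOn_metricDeriv (p : M) (k i j : Fin 2) :
    ContDiffOn ℝ ∞ (fun y ↦ metricDeriv p y k i j) (extChartAt (𝓡 2) p).target :=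
  ((contDiffOn_metricMatrix p i j).fderiv_of_isOpen (isOpen_extChartAt_target p)
    (m := ∞) (by simp)).clm_apply contDiffOn_const

theorem contDiffOn_det_metricMatrix (p : M) :
    ContDiffOn ℝ ∞ (fun y ↦ (metricMatrix p y).det) (extChartAt (𝓡 2) p).target := by
  simp only [Matrix.det_fin_two]
  exact ((contDiffOn_metricMatrix p 0 0).mul (contDiffOn_metricMatrix p 1 1)).sub
    ((contDiffOn_metricMatrix p 0 1).mul (contDiffOn_metricMatrix p 1 0))

theorem contDiffOn_metricMatrix_inv (p : M) (i j : Fin 2) :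
    ContDiffOn ℝ ∞ (fun y ↦ (metricMatrix p y)⁻¹ i j) (extChartAt (𝓡 2) p).target := by
  simp only [Matrix.inv_def, Ring.inverse_eq_inv', Matrix.smul_apply, smul_eq_mul,
    Matrix.adjugate_fin_two]
  refine ((contDiffOn_det_metricMatrix p).inv fun y hy ↦ (det_metricMatrix_pos hy).ne').mul ?_
  fin_cases i <;> fin_cases j
  · exact contDiffOn_metricMatrix p 1 1
  · exact (contDiffOn_metricMatrix p 0 1).neg
  · exact (contDiffOn_metricMatrix p 1 0).neg
  · exact contDiffOn_metricMatrix p 0 0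

theorem contDiffOn_christoffel (p : M) (k i j : Fin 2) :
    ContDiffOn ℝ ∞ (fun y ↦ christoffel p y k i j) (extChartAt (𝓡 2) p).target :=
  contDiffOn_const.mul (ContDiffOn.sum fun l _ ↦ (contDiffOn_metricMatrix_inv p k l).mul
    (((contDiffOn_metricDeriv p i j l).add (contDiffOn_metricDeriv p j i l)).sub
      (contDiffOn_metricDeriv p l i j)))

theorem ContDiffOn.christoffelVec {E : Type*} [NormedAddCommGroup E] [NormedSpace ℝ E] {s : Set E}
    {y u v : E → Plane} {p : M} (hy : ContDiffOn ℝ ∞ y s)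
    (hys : MapsTo y s (extChartAt (𝓡 2) p).target) (hu : ContDiffOn ℝ ∞ u s)
    (hv : ContDiffOn ℝ ∞ v s) :
    ContDiffOn ℝ ∞ (fun z ↦ christoffelVec p (y z) (u z) (v z)) s := by
  refine contDiffOn_euclidean.2 fun k ↦ ?_
  change ContDiffOn ℝ ∞ (fun z ↦ ∑ i, ∑ j, christoffel p (y z) k i j * u z i * v z j) s
  exact ContDiffOn.sum fun i _ ↦ ContDiffOn.sum fun j _ ↦
    (((contDiffOn_christoffel p k i j).comp hy hys).mul (contDiffOn_euclidean.1 hu i)).mul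
      (contDiffOn_euclidean.1 hv j)

theorem fderiv_metricForm {p : M} {y : Plane} (hy : y ∈ (extChartAt (𝓡 2) p).target)
    (u v w : Plane) : fderiv ℝ (metricForm p) y u v w =
      ∑ k, ∑ i, ∑ j, metricDeriv p y k i j * (u k * (v i * w j)) := by
  have hd i j : HasFDerivAt (fun y ↦ metricMatrix p y i j)
      (fderiv ℝ (fun y ↦ metricMatrix p y i j) y) y :=
    (((contDiffOn_metricMatrix p i j).contDiffAt
      ((isOpen_extChartAt_target p).mem_nhds hy)).differentiableAt (by simp)).hasFDerivAt
  have h1 : HasFDerivAt (metricForm p) _ y :=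
    HasFDerivAt.fun_sum (u := Finset.univ) fun i _ ↦ HasFDerivAt.fun_sum (u := Finset.univ)
      fun j _ ↦ (hd i j).smul_const ((EuclideanSpace.proj (𝕜 := ℝ) i : Plane →L[ℝ] ℝ).smulRight
      (EuclideanSpace.proj (𝕜 := ℝ) j : Plane →L[ℝ] ℝ))
  have hu (L : Plane →L[ℝ] ℝ) : L u = ∑ k, u k * L (EuclideanSpace.single k 1) := by
    have h : u = ∑ i, u i • EuclideanSpace.single i (1 : ℝ) := by
      ext i; fin_cases i <;> simp
    conv_lhs => rw [h]
    simp only [map_sum, map_smul, smul_eq_mul]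
  rw [h1.fderiv]
  simp only [Fin.sum_univ_two, add_apply, ContinuousLinearMap.smulRight_apply, smul_apply,
    smul_eq_mul, hu, PiLp.proj_apply, metricDeriv]
  ring

/-- The Christoffel symbols are characterized by the Koszul formula. -/
theorem metricForm_christoffelVec {p : M} {y : Plane} (hy : y ∈ (extChartAt (𝓡 2) p).target)
    (u v w : Plane) : metricForm p y (christoffelVec p y u v) w =
      (1 / 2) * (fderiv ℝ (metricForm p) y u v w + fderiv ℝ (metricForm p) y v u w -
        fderiv ℝ (metricForm p) y w u v) := by
  have hs k i j : metricDeriv p y k i j = metricDeriv p y k j i := by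
    simp only [metricDeriv, metricMatrix_symm p _ i j]
  have hdet := det_metricMatrix_pos hy
  have h1 : (metricMatrix p y) * (metricMatrix p y)⁻¹ = 1 :=
    Matrix.mul_nonsing_inv _ (isUnit_iff_ne_zero.2 hdet.ne')
  -- Lowering the upper index of a Christoffel symbol cancels the inverse matrix in its definition.
  have h2 (j : Fin 2) (c : Fin 2 → ℝ) :
      ∑ k, metricMatrix p y k j * ∑ l, (metricMatrix p y)⁻¹ k l * c l = c j := by
    have := congrFun (congrArg (·.mulVec c) h1) j
    rw [← Matrix.mulVec_mulVec, Matrix.one_mulVec] at this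
    rw [← this]
    change _ = ∑ k, metricMatrix p y j k * ∑ l, (metricMatrix p y)⁻¹ k l * c l
    exact Finset.sum_congr rfl fun k _ ↦ by rw [metricMatrix_symm p y k j]
  have h3 (i j l : Fin 2) : ∑ k, metricMatrix p y k l * christoffel p y k i j =
      (1 / 2) * (metricDeriv p y i j l + metricDeriv p y j i l - metricDeriv p y l i j) := by
    rw [← h2 l fun l ↦ (1 / 2) *
      (metricDeriv p y i j l + metricDeriv p y j i l - metricDeriv p y l i j)]
    simp only [christoffel, Fin.sum_univ_two]
    ring
  have h4 (l : Fin 2) : ∑ k, metricMatrix p y k l * christoffelVec p y u v k = ∑ i, ∑ j,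
      ((1 / 2) * (metricDeriv p y i j l + metricDeriv p y j i l - metricDeriv p y l i j)) *
        (u i * v j) := by
    simp only [← h3, christoffelVec, Fin.sum_univ_two]
    ring
  have h5 : metricForm p y (christoffelVec p y u v) w =
      ∑ l, (∑ k, metricMatrix p y k l * christoffelVec p y u v k) * w l := by
    simp only [metricForm_apply, Fin.sum_univ_two]
    ring
  rw [h5]
  simp only [h4, fderiv_metricForm hy, Fin.sum_univ_two]
  rw [hs 0 1 0, hs 1 1 0]
  ring

end Smooth

end Metric

/-! ### Coordinate invariance of the acceleration -/

section Pullback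

variable {E : Type*} [NormedAddCommGroup E] [NormedSpace ℝ E]

/-- The Koszul expression of a metric on a vector space, which determines its Levi-Civita
connection. -/
noncomputable def koszul (B : E → BilinForm E) (y u v w : E) : ℝ :=
  (1 / 2) * (fderiv ℝ B y u v w + fderiv ℝ B y v u w - fderiv ℝ B y w u v)

/-- Each derivative of the pulled-back metric contributes two terms with the second derivative of φ.
By symmetry of that derivative and of B', the Koszul combination keeps only the one with d²φ(u, v):
the inhomogeneous term in the transformation law of Christoffel symbols. -/
theorem koszul_pullback {B B' : E → BilinForm E} {φ : E → E} {y : E}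
    (hφ : ContDiffAt ℝ 2 φ y) (hB' : DifferentiableAt ℝ B' (φ y))
    (hsymm : ∀ v w, B' (φ y) v w = B' (φ y) w v)
    (h : ∀ᶠ z in 𝓝 y, ∀ v w, B z v w = B' (φ z) (fderiv ℝ φ z v) (fderiv ℝ φ z w))
    (hB : DifferentiableAt ℝ B y) (u v w : E) :
    koszul B y u v w =
      koszul B' (φ y) (fderiv ℝ φ y u) (fderiv ℝ φ y v) (fderiv ℝ φ y w) +
        B' (φ y) (fderiv ℝ (fderiv ℝ φ) y u v) (fderiv ℝ φ y w) := by
  have hφ1 : HasFDerivAt φ (fderiv ℝ φ y) y := (hφ.differentiableAt (by simp)).hasFDerivAt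
  have hφ2 : HasFDerivAt (fderiv ℝ φ) (fderiv ℝ (fderiv ℝ φ) y) y :=
    ((hφ.fderiv_right (m := 1) (by norm_num)).differentiableAt (by simp)).hasFDerivAt
  have hs (a b : E) : fderiv ℝ (fderiv ℝ φ) y a b = fderiv ℝ (fderiv ℝ φ) y b a :=
    hφ.isSymmSndFDerivAt (by simp) a b
  have key (a b c : E) : fderiv ℝ B y a b c =
      fderiv ℝ B' (φ y) (fderiv ℝ φ y a) (fderiv ℝ φ y b) (fderiv ℝ φ y c) +
        B' (φ y) (fderiv ℝ (fderiv ℝ φ) y a b) (fderiv ℝ φ y c) +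
        B' (φ y) (fderiv ℝ φ y b) (fderiv ℝ (fderiv ℝ φ) y a c) := by
    have h1 := (hB.hasFDerivAt.clm_apply (hasFDerivAt_const b y)).clm_apply (hasFDerivAt_const c y)
    have hB1 : HasFDerivAt (fun z ↦ B' (φ z)) ((fderiv ℝ B' (φ y)).comp (fderiv ℝ φ y)) y :=
      HasFDerivAt.comp (G := BilinForm E) y hB'.hasFDerivAt hφ1
    have h2 := (hB1.clm_apply
      (hφ2.clm_apply (hasFDerivAt_const b y))).clm_apply (hφ2.clm_apply (hasFDerivAt_const c y))
    have h3 := h1.unique (h2.congr_of_eventuallyEq (h.mono fun z hz ↦ hz b c))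
    have h4 := congrArg (· a) h3
    simp at h4
    rw [h4]
    ring
  simp only [koszul, key, hs v u, hs w u, hs w v, hsymm (fderiv ℝ φ y u), hsymm (fderiv ℝ φ y v)]
  ring

/-- The acceleration of a curve with respect to the Levi-Civita connection of a metric does not
depend on the coordinates. -/
theorem acceleration_pullback {B B' : E → BilinForm E} {φ : E → E} {x y : ℝ → E} {t : ℝ}
    (hφ : ContDiffAt ℝ 2 φ (x t)) (hB' : DifferentiableAt ℝ B' (φ (x t)))
    (hsymm : ∀ v w, B' (φ (x t)) v w = B' (φ (x t)) w v)
    (h : ∀ᶠ z in 𝓝 (x t), ∀ v w, B z v w = B' (φ z) (fderiv ℝ φ z v) (fderiv ℝ φ z w))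
    (hB : DifferentiableAt ℝ B (x t)) (hx : ContDiffAt ℝ 2 x t) (hy : y =ᶠ[𝓝 t] φ ∘ x) {a b : E}
    (ha : ∀ w, B (x t) a w =
      B (x t) (deriv (deriv x) t) w + koszul B (x t) (deriv x t) (deriv x t) w)
    (hb : ∀ w, B' (y t) b w =
      B' (y t) (deriv (deriv y) t) w + koszul B' (y t) (deriv y t) (deriv y t) w) (w : E) :
    B' (y t) (fderiv ℝ φ (x t) a) (fderiv ℝ φ (x t) w) = B' (y t) b (fderiv ℝ φ (x t) w) := by
  have hyt : y t = φ (x t) := hy.self_of_nhds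
  have hd : ∀ᶠ s in 𝓝 t, HasDerivAt x (deriv x s) s ∧ DifferentiableAt ℝ φ (x s) := by
    filter_upwards [hx.eventually (by simp), hx.continuousAt.eventually (hφ.eventually (by simp))]
      with s h1 h2
    exact ⟨(h1.differentiableAt (by simp)).hasDerivAt, h2.differentiableAt (by simp)⟩
  have hy' : deriv y =ᶠ[𝓝 t] fun s ↦ fderiv ℝ φ (x s) (deriv x s) := by
    filter_upwards [hy.eventuallyEq_nhds, hd] with s h1 ⟨h2, h3⟩
    rw [h1.deriv_eq]
    exact (h3.hasFDerivAt.comp_hasDerivAt s h2).deriv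
  have hx' : HasDerivAt (deriv x) (deriv (deriv x) t) t := by
    have h1 : ContDiffAt ℝ 1 (deriv x) t :=
      (hx.fderiv_right (m := 1) (by norm_num)).clm_apply (contDiffAt_const (c := (1 : ℝ)))
    exact (h1.differentiableAt (by simp)).hasDerivAt
  have hy'' : deriv (deriv y) t = fderiv ℝ (fderiv ℝ φ) (x t) (deriv x t) (deriv x t) +
      fderiv ℝ φ (x t) (deriv (deriv x) t) := by
    have hφ2 : HasFDerivAt (fderiv ℝ φ) (fderiv ℝ (fderiv ℝ φ) (x t)) (x t) :=
      ((hφ.fderiv_right (m := 1) (by norm_num)).differentiableAt (by simp)).hasFDerivAt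
    rw [hy'.deriv_eq]
    exact ((hφ2.comp_hasDerivAt t hd.self_of_nhds.1).clm_apply hx').deriv
  -- The term d²φ(x', x') of y'' is exactly the one that `koszul_pullback` adds to the Koszul
  -- expression.
  rw [hb, hy'', hy'.self_of_nhds, hyt, ← h.self_of_nhds, ha, h.self_of_nhds,
    koszul_pullback hφ hB' hsymm h hB, map_add, add_apply]
  ring

end Pullback

/-! ### Change of chart -/

section Chart

variable {M : Type*} [TopologicalSpace M] [ChartedSpace Plane M]

/-- The change of coordinates from the chart at `q` to the chart at `p`. -/
noncomputable def chartChange (q p : M) : Plane → Plane :=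
  extChartAt (𝓡 2) p ∘ (extChartAt (𝓡 2) q).symm

theorem chartChange_extChartAt {q m : M} (p : M) (hq : m ∈ (chartAt Plane q).source) :
    chartChange q p (extChartAt (𝓡 2) q m) = extChartAt (𝓡 2) p m :=
  congrArg (extChartAt (𝓡 2) p)
    ((extChartAt (𝓡 2) q).left_inv (by rwa [extChartAt_source]))

variable [IsManifold (𝓡 2) ∞ M]

theorem contDiffAt_chartChange {p q m : M} (hq : m ∈ (chartAt Plane q).source)
    (hp : m ∈ (chartAt Plane p).source) :
    ContDiffAt ℝ ∞ (chartChange q p) (extChartAt (𝓡 2) q m) := by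
  have h : extChartAt (𝓡 2) q m ∈ ((extChartAt (𝓡 2) q).symm ≫ extChartAt (𝓡 2) p).source := by
    rw [PartialEquiv.trans_source'', PartialEquiv.symm_symm, PartialEquiv.symm_target]
    exact mem_image_of_mem _ ⟨by rwa [extChartAt_source], by rwa [extChartAt_source]⟩
  have h1 := contDiffWithinAt_ext_coord_change (I := 𝓡 2) (n := ∞) p q h
  rwa [ModelWithCorners.range_eq_univ, contDiffWithinAt_univ] at h1

theorem components_eq_fderiv {p q m : M} (hq : m ∈ (chartAt Plane q).source)
    (hp : m ∈ (chartAt Plane p).source) (v : TangentSpace (𝓡 2) m) :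
    components p v = fderiv ℝ (chartChange q p) (extChartAt (𝓡 2) q m) (components q v) := by
  have h := tangentCoordChange_comp (I := 𝓡 2) (w := m) (x := q) (y := p) (z := m) (v := v)
    ⟨⟨mem_extChartAt_source m, by rwa [extChartAt_source]⟩, by rwa [extChartAt_source]⟩
  rw [components, components, TangentBundle.continuousLinearMapAt_trivializationAt_eq_core hp,
    TangentBundle.continuousLinearMapAt_trivializationAt_eq_core hq]
  rw [tangentCoordChange_def (x := q), ModelWithCorners.range_eq_univ, fderivWithin_univ] at h
  exact h.symm

theorem components_velocity {p : M} {γ : ℝ → M} {t : ℝ}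
    (hγ : MDifferentiableAt 𝓘(ℝ, ℝ) (𝓡 2) γ t) (hp : γ t ∈ (chartAt Plane p).source) :
    components p (velocity γ t) = deriv (chartCurve p γ) t := by
  have h1 : MDifferentiableAt (𝓡 2) (𝓡 2) (extChartAt (𝓡 2) p) (γ t) :=
    mdifferentiableAt_extChartAt hp
  have h2 := mfderiv_comp t h1 hγ
  rw [components, TangentBundle.continuousLinearMapAt_trivializationAt hp, velocity]
  have h3 := congrArg (fun L ↦ L (1 : ℝ)) h2
  rw [mfderiv_eq_fderiv] at h3
  exact h3.symm

theorem contDiffAt_chartCurve {p : M} {γ : ℝ → M} {t : ℝ}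
    (hγ : ContMDiffAt 𝓘(ℝ, ℝ) (𝓡 2) ∞ γ t) (hp : γ t ∈ (chartAt Plane p).source) :
    ContDiffAt ℝ ∞ (chartCurve p γ) t :=
  contMDiffAt_iff_contDiffAt.1 ((contMDiffAt_extChartAt' hp).comp t hγ)

variable [RiemannianBundle (fun p : M ↦ TangentSpace (𝓡 2) p)]

theorem metricForm_eq_chartChange {p q m : M} (hq : m ∈ (chartAt Plane q).source)
    (hp : m ∈ (chartAt Plane p).source) (v w : Plane) :
    metricForm q (extChartAt (𝓡 2) q m) v w =
      metricForm p (chartChange q p (extChartAt (𝓡 2) q m))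
        (fderiv ℝ (chartChange q p) (extChartAt (𝓡 2) q m) v)
        (fderiv ℝ (chartChange q p) (extChartAt (𝓡 2) q m) w) := by
  rw [chartChange_extChartAt p hq]
  conv_lhs => rw [← components_symmL hq v, ← components_symmL hq w]
  conv_rhs => rw [← components_symmL hq v, ← components_symmL hq w]
  rw [← components_eq_fderiv hq hp, ← components_eq_fderiv hq hp, metricForm_components hq,
    metricForm_components hp]

variable [IsContMDiffRiemannianBundle (𝓡 2) ∞ Plane (fun p : M ↦ TangentSpace (𝓡 2) p)]

theorem metricForm_covDeriv_eq_koszul {p : M} {y : Plane} (hy : y ∈ (extChartAt (𝓡 2) p).target)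
    (a u w : Plane) : metricForm p y (a + christoffelVec p y u u) w =
      metricForm p y a w + koszul (metricForm p) y u u w := by
  rw [map_add, add_apply, metricForm_christoffelVec hy, koszul]

/-- The acceleration may be computed in any chart. -/
theorem components_acceleration {p : M} {γ : ℝ → M} {t : ℝ}
    (hγ : ∀ᶠ s in 𝓝 t, ContMDiffAt 𝓘(ℝ, ℝ) (𝓡 2) ∞ γ s) (hp : γ t ∈ (chartAt Plane p).source) :
    components p (acceleration γ t) = deriv (deriv (chartCurve p γ)) t +
      christoffelVec p (chartCurve p γ t) (deriv (chartCurve p γ) t)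
        (deriv (chartCurve p γ) t) := by
  have hγt := hγ.self_of_nhds
  set q := γ t with hq_def
  have hq : γ t ∈ (chartAt Plane q).source := mem_chart_source Plane q
  have hv : (fun s ↦ components q (velocity γ s)) =ᶠ[𝓝 t] deriv (chartCurve q γ) := by
    filter_upwards [hγ, hγt.continuousAt.eventually
      ((chartAt Plane q).open_source.mem_nhds hq)] with s h1 h2
    exact components_velocity (h1.mdifferentiableAt (by simp)) h2
  -- In the chart at γ(t) itself the formula is the definition of the covariant derivative; the rest
  -- transports it to the chart at p.
  have hacc : components q (acceleration γ t) = deriv (deriv (chartCurve q γ)) t +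
      christoffelVec q (chartCurve q γ t) (deriv (chartCurve q γ) t)
        (deriv (chartCurve q γ) t) := by
    rw [acceleration, covDeriv, components_symmL hq, covDerivComponents_eq, hv.deriv_eq]
    congr 2
    exact hv.self_of_nhds
  have hmem {p' : M} (h : γ t ∈ (chartAt Plane p').source) :
      chartCurve p' γ t ∈ (extChartAt (𝓡 2) p').target :=
    (extChartAt (𝓡 2) p').map_source (by rwa [extChartAt_source])
  have hdiff {p' : M} (h : γ t ∈ (chartAt Plane p').source) :
      DifferentiableAt ℝ (metricForm p') (chartCurve p' γ t) :=
    ((contDiffOn_metricForm p').contDiffAt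
      ((isOpen_extChartAt_target p').mem_nhds (hmem h))).differentiableAt (by simp)
  have hchange : chartChange q p (chartCurve q γ t) = chartCurve p γ t :=
    chartChange_extChartAt p hq
  have hform : ∀ᶠ z in 𝓝 (chartCurve q γ t), ∀ v w, metricForm q z v w =
      metricForm p (chartChange q p z) (fderiv ℝ (chartChange q p) z v)
        (fderiv ℝ (chartChange q p) z w) := by
    have h1 := (continuousAt_extChartAt_symm'' (I := 𝓡 2) (hmem hq)).eventually
      ((chartAt Plane p).open_source.mem_nhds (by
        rwa [chartCurve, (extChartAt (𝓡 2) q).left_inv (by rwa [extChartAt_source])]))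
    filter_upwards [h1, (isOpen_extChartAt_target q).mem_nhds (hmem hq)] with z h2 h3
    have h4 : (extChartAt (𝓡 2) q).symm z ∈ (chartAt Plane q).source := by
      rw [← extChartAt_source (𝓡 2) q]
      exact (extChartAt (𝓡 2) q).map_target h3
    have h5 := metricForm_eq_chartChange h4 h2
    rwa [(extChartAt (𝓡 2) q).right_inv h3] at h5
  have hcurve : chartCurve p γ =ᶠ[𝓝 t] chartChange q p ∘ chartCurve q γ := by
    filter_upwards [hγt.continuousAt.eventually
      ((chartAt Plane q).open_source.mem_nhds hq)] with s hs
    exact (chartChange_extChartAt p hs).symm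
  have key := acceleration_pullback (B := metricForm q) (B' := metricForm p)
    (φ := chartChange q p) (x := chartCurve q γ) (y := chartCurve p γ) (t := t)
    ((contDiffAt_chartChange hq hp).of_le (by norm_cast)) (by rw [hchange]; exact hdiff hp)
    (fun v w ↦ metricForm_symm _ _ _ _) hform (hdiff hq)
    ((contDiffAt_chartCurve hγt hq).of_le (by norm_cast)) hcurve
    (fun w ↦ metricForm_covDeriv_eq_koszul (hmem hq) _ _ w)
    (fun w ↦ metricForm_covDeriv_eq_koszul (hmem hp) _ _ w)
  rw [components_eq_fderiv hq hp, hacc]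
  refine metricForm_ext (hmem hp) fun w ↦ ?_
  -- The derivative of the coordinate change is onto, so the identity `key` tests against every
  -- vector.
  have hw : fderiv ℝ (chartChange q p) (chartCurve q γ t)
      (components q ((chartTriv p).symmL ℝ (γ t) w)) = w := by
    rw [chartCurve, ← components_eq_fderiv hq hp, components_symmL hp]
  have h := key (components q ((chartTriv p).symmL ℝ (γ t) w))
  rw [hw] at h
  exact h

end Chart

/-! ### The area form in a basis -/

section AreaForm

/-- An alternating form in dimension two is determined by its value on the basis. That value is
positive by the choice of orientation, and its square is the Gram determinant, since ⟨a, b⟩² + ω(a,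
b)² = |a|² |b|². -/
theorem areaForm_basis_orientation {V : Type*} [NormedAddCommGroup V] [InnerProductSpace ℝ V]
    [Fact (Module.finrank ℝ V = 2)] (b : Module.Basis (Fin 2) ℝ V) (v w : V) :
    b.orientation.areaForm v w =
      √(inner ℝ (b 0) (b 0) * inner ℝ (b 1) (b 1) - inner ℝ (b 0) (b 1) ^ 2) *
        (b.repr v 0 * b.repr w 1 - b.repr v 1 * b.repr w 0) := by
  have hfin : Module.finrank ℝ V = 2 := Fact.out
  set o := b.orientation
  let e := o.finOrthonormalBasis two_pos hfin
  have he : e.toBasis.orientation = o := o.finOrthonormalBasis_orientation two_pos hfin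
  have hvol (x y : V) : o.areaForm x y = e.toBasis.det ![x, y] := by
    rw [Orientation.areaForm_to_volumeForm, Orientation.volumeForm_robust o e he]
  have hpos : 0 < o.areaForm (b 0) (b 1) := by
    rw [hvol, show ![b 0, b 1] = b by ext i; fin_cases i <;> rfl]
    exact (Module.Basis.orientation_eq_iff_det_pos e.toBasis b).1 he
  have hsq : o.areaForm (b 0) (b 1) =
      √(inner ℝ (b 0) (b 0) * inner ℝ (b 1) (b 1) - inner ℝ (b 0) (b 1) ^ 2) := by
    rw [eq_comm, Real.sqrt_eq_iff_mul_self_eq_of_pos hpos]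
    have h := o.inner_sq_add_areaForm_sq (b 0) (b 1)
    rw [real_inner_self_eq_norm_sq, real_inner_self_eq_norm_sq]
    linarith
  rw [← hsq]
  have hsum (x : V) : x = b.repr x 0 • b 0 + b.repr x 1 • b 1 := by
    conv_lhs => rw [← b.sum_repr x, Fin.sum_univ_two]
  conv_lhs => rw [hsum v, hsum w]
  simp only [map_add, map_smul, LinearMap.add_apply, LinearMap.smul_apply,
    Orientation.areaForm_apply_self, smul_eq_mul, o.areaForm_swap (b 1) (b 0)]
  ring

end AreaForm

/-! ### The area form in a chart -/

section Bracket

variable {M : Type*} [TopologicalSpace M] [ChartedSpace Plane M] [IsManifold (𝓡 2) ∞ M]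

/-- The basis of coordinate vectors of the chart at `p`. -/
noncomputable def coordBasis (p q : M) (hq : q ∈ (chartAt Plane p).source) :
    Module.Basis (Fin 2) ℝ (TangentSpace (𝓡 2) q) :=
  (EuclideanSpace.basisFun (Fin 2) ℝ).toBasis.map (componentEquiv p q hq).symm

variable [RiemannianBundle (fun p : M ↦ TangentSpace (𝓡 2) p)]

theorem areaForm_coordBasis {p q : M} (hq : q ∈ (chartAt Plane p).source)
    (v w : TangentSpace (𝓡 2) q) :
    (coordBasis p q hq).orientation.areaForm v w =
      √(metricMatrix p (extChartAt (𝓡 2) p q)).det *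
        (components p v 0 * components p w 1 - components p v 1 * components p w 0) := by
  have hb (i : Fin 2) : coordBasis p q hq i = coordVec p q i := by
    simp only [coordBasis, Module.Basis.map_apply, OrthonormalBasis.coe_toBasis,
      EuclideanSpace.basisFun_apply, coordVec]
    exact congrFun ((chartTriv p).symm_continuousLinearEquivAt_eq hq) _
  have hr (v : TangentSpace (𝓡 2) q) (i : Fin 2) :
      (coordBasis p q hq).repr v i = components p v i := by
    exact congrArg (fun c : Plane ↦ c i)
      (congrFun ((chartTriv p).coe_continuousLinearEquivAt_eq hq) v)
  rw [areaForm_basis_orientation]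
  simp only [hb, hr, ← metricMatrix_extChartAt hq, det_metricMatrix]

/-- Near `p`, the area form is given in the chart at `p` by the square root of the determinant of
the metric, up to a constant sign. -/
theorem exists_bracket_eq (o : SurfaceOrientation M) (p : M) :
    ∃ ε : ℝ, (ε = 1 ∨ ε = -1) ∧ ∀ᶠ q in 𝓝 p, ∀ v w : TangentSpace (𝓡 2) q,
      bracket o v w = ε * √(metricMatrix p (extChartAt (𝓡 2) p q)).det *
        (components p v 0 * components p w 1 - components p v 1 * components p w 0) := by
  set O := Orientation.map (Fin 2) (componentEquiv p p (mem_chart_source Plane p)) (o.orient p)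
  have key : ∀ᶠ q in 𝓝 p, ∃ hq : q ∈ (chartAt Plane p).source,
      o.orient q = Orientation.map (Fin 2) (componentEquiv p q hq).symm O := by
    filter_upwards [o.locallyConstant p,
      (chartAt Plane p).open_source.mem_nhds (mem_chart_source Plane p)] with q h hq
    refine ⟨hq, ?_⟩
    have h' : Orientation.map (Fin 2) (componentEquiv p q hq) (o.orient q) = O := h hq
    rw [← h', ← Orientation.map_symm]
    exact (Equiv.symm_apply_apply _ _).symm
  have hmap {q : M} (hq : q ∈ (chartAt Plane p).source) :
      Orientation.map (Fin 2) (componentEquiv p q hq).symm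
        (EuclideanSpace.basisFun (Fin 2) ℝ).toBasis.orientation =
          (coordBasis p q hq).orientation :=
    (Module.Basis.orientation_map _ _).symm
  -- The plane has just two orientations, and near p the transported one is constantly O; this fixes
  -- one sign for all nearby points.
  rcases (EuclideanSpace.basisFun (Fin 2) ℝ).toBasis.orientation_eq_or_eq_neg O with hO | hO
  · refine ⟨1, Or.inl rfl, key.mono fun q ⟨hq, h⟩ v w ↦ ?_⟩
    rw [bracket, h, hO, hmap hq, areaForm_coordBasis hq, one_mul]
  · refine ⟨-1, Or.inr rfl, key.mono fun q ⟨hq, h⟩ v w ↦ ?_⟩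
    rw [bracket, h, hO, Orientation.map_neg, hmap hq, Orientation.areaForm_neg_orientation,
      LinearMap.neg_apply, LinearMap.neg_apply, areaForm_coordBasis hq]
    ring

end Bracket

/-! ### Arclength when the speed is |t| c(t) -/

section Arclength

theorem intervalIntegral_abs_mul_eq_radialMean (c : ℝ → ℝ) (t : ℝ) :
    ∫ u in (0 : ℝ)..t, |u| * c u = |t| * t * radialMean 1 c t := by
  have h := intervalIntegral_pow_smul_eq_radialMean 1 c t
  simp only [pow_one, smul_eq_mul] at h
  rcases le_total 0 t with ht | ht
  · have h1 : ∫ u in (0 : ℝ)..t, |u| * c u = ∫ u in (0 : ℝ)..t, u * c u := by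
      refine intervalIntegral.integral_congr fun u hu ↦ ?_
      rw [uIcc_of_le ht] at hu
      simp only [abs_of_nonneg hu.1]
    rw [h1, h, abs_of_nonneg ht]
    ring
  · have h1 : ∫ u in (0 : ℝ)..t, |u| * c u = ∫ u in (0 : ℝ)..t, -(u * c u) := by
      refine intervalIntegral.integral_congr fun u hu ↦ ?_
      rw [uIcc_of_ge ht] at hu
      simp only [abs_of_nonpos hu.2, neg_mul]
    rw [h1, intervalIntegral.integral_neg, h, abs_of_nonpos ht]
    ring

variable {M : Type*} [TopologicalSpace M] [ChartedSpace Plane M]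
  [RiemannianBundle (fun p : M ↦ TangentSpace (𝓡 2) p)]

theorem arclength_eq {γ : ℝ → M} {c : ℝ → ℝ} {t : ℝ}
    (h : ∀ u, |u| ≤ |t| → ‖velocity γ u‖ = |u| * c u) :
    arclength γ t = |t| * t * radialMean 1 c t := by
  rw [← intervalIntegral_abs_mul_eq_radialMean]
  refine intervalIntegral.integral_congr fun u hu ↦ h u ?_
  have := Set.abs_sub_left_of_mem_uIcc hu
  rwa [sub_zero, sub_zero] at this

theorem sqrt_abs_arclength_eq {γ : ℝ → M} {m t : ℝ} (h : arclength γ t = |t| * t * m) (hm : 0 ≤ m) :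
    √|arclength γ t| = |t| * √m := by
  rw [h, abs_mul, abs_mul, abs_abs, abs_of_nonneg hm, Real.sqrt_mul (by positivity),
    Real.sqrt_mul_self (abs_nonneg t)]

/-- The absolute value disappears because sgn(t) |t| = t, also at t = 0; this is why τ is smooth
although √|s_g| is not. -/
theorem halfArclength_eq {γ : ℝ → M} {m t : ℝ} (h : arclength γ t = |t| * t * m) (hm : 0 ≤ m) :
    halfArclength γ t = t * √m := by
  rw [halfArclength, sqrt_abs_arclength_eq h hm, ← mul_assoc]
  congr 1
  rcases lt_trichotomy t 0 with ht | rfl | ht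
  · rw [Real.sign_of_neg ht, abs_of_neg ht]; ring
  · simp
  · rw [Real.sign_of_pos ht, abs_of_pos ht]; ring

end Arclength

/-! ### Acceleration, curvature and third derivative for velocity t w -/

section Formulas

variable {M : Type*} [TopologicalSpace M] [ChartedSpace Plane M] [IsManifold (𝓡 2) ∞ M]
  [RiemannianBundle (fun p : M ↦ TangentSpace (𝓡 2) p)]

/-- The area form of the metric in the coordinates of the chart at `p`, up to sign. -/
noncomputable def chartArea (p : M) (y u v : Plane) : ℝ :=
  √(metricMatrix p y).det * (u 0 * v 1 - u 1 * v 0)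

theorem chartArea_smul_left (p : M) (y u v : Plane) (a : ℝ) :
    chartArea p y (a • u) v = a * chartArea p y u v := by
  simp only [chartArea, PiLp.smul_apply, smul_eq_mul]
  ring

theorem chartArea_smul_right (p : M) (y u v : Plane) (a : ℝ) :
    chartArea p y u (a • v) = a * chartArea p y u v := by
  simp only [chartArea, PiLp.smul_apply, smul_eq_mul]
  ring

theorem chartArea_self_add (p : M) (y u v : Plane) :
    chartArea p y u (u + v) = chartArea p y u v := by
  simp only [chartArea, PiLp.add_apply]
  ring

/-- The norm of a vector of the plane with respect to the metric in the chart at `p`. -/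
noncomputable def chartNorm (p : M) (y v : Plane) : ℝ := √(metricForm p y v v)

theorem chartNorm_components {p q : M} (hq : q ∈ (chartAt Plane p).source)
    (v : TangentSpace (𝓡 2) q) : chartNorm p (extChartAt (𝓡 2) p q) (components p v) = ‖v‖ := by
  rw [chartNorm, metricForm_self_components hq, Real.sqrt_sq (norm_nonneg v)]

theorem chartNorm_smul (p : M) (y v : Plane) (a : ℝ) :
    chartNorm p y (a • v) = |a| * chartNorm p y v := by
  rw [chartNorm, chartNorm, map_smul, map_smul (metricForm p y), smul_apply, smul_eq_mul,
    smul_eq_mul, ← mul_assoc, Real.sqrt_mul (mul_self_nonneg a), Real.sqrt_mul_self_eq_abs]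

theorem chartNorm_pos {p : M} {y : Plane} (hy : y ∈ (extChartAt (𝓡 2) p).target) {v : Plane}
    (hv : v ≠ 0) : 0 < chartNorm p y v :=
  Real.sqrt_pos.2 (metricForm_self_pos hy hv)

/-- The covariant derivative of `w` along a curve with velocity `t w`, in the chart at `p`. -/
noncomputable def rescaledCovDeriv (p : M) (γ : ℝ → M) (w : ℝ → Plane) (t : ℝ) : Plane :=
  deriv w t + t • christoffelVec p (chartCurve p γ t) (w t) (w t)

theorem norm_velocity_eq {p : M} {γ : ℝ → M} {w : ℝ → Plane} {t : ℝ}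
    (hγ : ContMDiffAt 𝓘(ℝ, ℝ) (𝓡 2) ∞ γ t) (hp : γ t ∈ (chartAt Plane p).source)
    (hx : HasDerivAt (chartCurve p γ) (t • w t) t) :
    ‖velocity γ t‖ = |t| * chartNorm p (chartCurve p γ t) (w t) := by
  rw [← chartNorm_components hp, components_velocity (hγ.mdifferentiableAt (by simp)) hp,
    hx.deriv, chartNorm_smul, chartCurve]

variable [IsContMDiffRiemannianBundle (𝓡 2) ∞ Plane (fun p : M ↦ TangentSpace (𝓡 2) p)]

/-- The product rule gives w + t w', and Γ(t w, t w) = t² Γ(w, w) is absorbed into the factor t. -/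
theorem components_acceleration_eq {p : M} {γ : ℝ → M} {w : ℝ → Plane} {t : ℝ}
    (hγ : ∀ᶠ s in 𝓝 t, ContMDiffAt 𝓘(ℝ, ℝ) (𝓡 2) ∞ γ s) (hp : γ t ∈ (chartAt Plane p).source)
    (hx : ∀ᶠ s in 𝓝 t, HasDerivAt (chartCurve p γ) (s • w s) s) (hw : DifferentiableAt ℝ w t) :
    components p (acceleration γ t) = w t + t • rescaledCovDeriv p γ w t := by
  have h1 : deriv (chartCurve p γ) =ᶠ[𝓝 t] fun s ↦ s • w s := hx.mono fun s hs ↦ hs.deriv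
  have h2 : HasDerivAt (fun s ↦ s • w s) (t • deriv w t + (1 : ℝ) • w t) t :=
    (hasDerivAt_id' t).smul hw.hasDerivAt
  rw [components_acceleration hγ hp, h1.deriv_eq, h2.deriv, h1.self_of_nhds,
    christoffelVec_smul_smul, rescaledCovDeriv, smul_add, smul_smul, one_smul]
  abel

/-- The bracket of t w with w + t D is t² [w, D], the cubed speed is |t|³ c³ and √|s_g| = |t| √m, so
t drops out. The right-hand side makes sense at t = 0 as well. -/
theorem normalizedCurvature_eq {o : SurfaceOrientation M} {p : M} {γ : ℝ → M} {w : ℝ → Plane}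
    {ε m t : ℝ}
    (hγ : ∀ᶠ s in 𝓝 t, ContMDiffAt 𝓘(ℝ, ℝ) (𝓡 2) ∞ γ s) (hp : γ t ∈ (chartAt Plane p).source)
    (hx : ∀ᶠ s in 𝓝 t, HasDerivAt (chartCurve p γ) (s • w s) s) (hw : DifferentiableAt ℝ w t)
    (hb : ∀ v v' : TangentSpace (𝓡 2) (γ t), bracket o v v' =
      ε * chartArea p (chartCurve p γ t) (components p v) (components p v'))
    (hs : arclength γ t = |t| * t * m) (hm : 0 ≤ m) (ht : t ≠ 0) :
    normalizedCurvature o γ t =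
      √m * (ε * chartArea p (chartCurve p γ t) (w t) (rescaledCovDeriv p γ w t)) /
        chartNorm p (chartCurve p γ t) (w t) ^ 3 := by
  have hγt := hγ.self_of_nhds
  have ht' : |t| ≠ 0 := abs_ne_zero.2 ht
  rw [normalizedCurvature, geodesicCurvature, hb, components_acceleration_eq hγ hp hx hw,
    components_velocity (hγt.mdifferentiableAt (by simp)) hp, hx.self_of_nhds.deriv,
    norm_velocity_eq hγt hp hx.self_of_nhds, sqrt_abs_arclength_eq hs hm, chartArea_smul_left,
    chartArea_self_add, chartArea_smul_right, mul_pow, ← mul_assoc t, ← pow_two, ← sq_abs t]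
  -- If c = 0, both sides are quotients by zero and hence 0.
  by_cases hc : chartNorm p (chartCurve p γ t) (w t) = 0
  · simp [hc]
  · field_simp

/-- The velocity vanishes at 0, which kills the Christoffel term; the derivative of w + t D there is
w'(0) + D(0), and D(0) = w'(0). -/
theorem components_thirdDeriv_zero {γ : ℝ → M} {w : ℝ → Plane}
    (hγ : ∀ᶠ s in 𝓝 0, ContMDiffAt 𝓘(ℝ, ℝ) (𝓡 2) ∞ γ s)
    (hx : ∀ᶠ s in 𝓝 0, HasDerivAt (chartCurve (γ 0) γ) (s • w s) s)
    (hw : ∀ᶠ s in 𝓝 0, DifferentiableAt ℝ w s)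
    (hD : DifferentiableAt ℝ (rescaledCovDeriv (γ 0) γ w) 0) :
    components (γ 0) (thirdDeriv γ 0) = (2 : ℝ) • deriv w 0 := by
  have hp := mem_chart_source Plane (γ 0)
  have h1 : (fun s ↦ components (γ 0) (acceleration γ s)) =ᶠ[𝓝 0]
      fun s ↦ w s + s • rescaledCovDeriv (γ 0) γ w s := by
    filter_upwards [hγ.eventually_nhds, hx.eventually_nhds, hw,
      hγ.self_of_nhds.continuousAt.eventually ((chartAt Plane (γ 0)).open_source.mem_nhds hp)]
      with s h1 h2 h3 h4
    exact components_acceleration_eq h1 h4 h2 h3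
  have h2 := hw.self_of_nhds.hasDerivAt.fun_add ((hasDerivAt_id' (0 : ℝ)).smul hD.hasDerivAt)
  have h3 : deriv (chartCurve (γ 0) γ) 0 = 0 := by rw [hx.self_of_nhds.deriv, zero_smul]
  rw [thirdDeriv, covDeriv, components_symmL hp, covDerivComponents_eq, h3,
    christoffelVec_zero_left, add_zero, h1.deriv_eq]
  refine h2.deriv.trans ?_
  rw [rescaledCovDeriv, zero_smul, zero_smul, add_zero, one_smul, zero_add, two_smul]

end Formulas

/-! ### Direct part: normalized curvature at a cusp -/

section Cusp

theorem exists_Ioo_of_eventually {P : ℝ → Prop} (h : ∀ᶠ t in 𝓝 (0 : ℝ), P t) :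
    ∃ r > 0, ∀ t ∈ Ioo (-r) r, P t := by
  obtain ⟨r, hr, h⟩ := Metric.eventually_nhds_iff_ball.1 h
  rw [Real.ball_eq_Ioo, zero_sub, zero_add] at h
  exact ⟨r, hr, h⟩

variable {M : Type*} [TopologicalSpace M] [ChartedSpace Plane M] [IsManifold (𝓡 2) ∞ M]
  [RiemannianBundle (fun p : M ↦ TangentSpace (𝓡 2) p)]
  [IsContMDiffRiemannianBundle (𝓡 2) ∞ Plane (fun p : M ↦ TangentSpace (𝓡 2) p)]

theorem ContDiffOn.metricForm_apply {E : Type*} [NormedAddCommGroup E] [NormedSpace ℝ E] {s : Set E}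
    {y u v : E → Plane} {p : M} (hy : ContDiffOn ℝ ∞ y s)
    (hys : MapsTo y s (extChartAt (𝓡 2) p).target) (hu : ContDiffOn ℝ ∞ u s)
    (hv : ContDiffOn ℝ ∞ v s) : ContDiffOn ℝ ∞ (fun z ↦ metricForm p (y z) (u z) (v z)) s := by
  simp only [CuspCurvature.metricForm_apply]
  exact ContDiffOn.sum fun i _ ↦ ContDiffOn.sum fun j _ ↦
    ((contDiffOn_metricMatrix p i j).comp hy hys).mul
      ((contDiffOn_euclidean.1 hu i).mul (contDiffOn_euclidean.1 hv j))

theorem ContDiffOn.chartNorm {E : Type*} [NormedAddCommGroup E] [NormedSpace ℝ E] {s : Set E}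
    {y v : E → Plane} {p : M} (hy : ContDiffOn ℝ ∞ y s)
    (hys : MapsTo y s (extChartAt (𝓡 2) p).target) (hv : ContDiffOn ℝ ∞ v s)
    (hv0 : ∀ z ∈ s, v z ≠ 0) : ContDiffOn ℝ ∞ (fun z ↦ chartNorm p (y z) (v z)) s :=
  (ContDiffOn.metricForm_apply hy hys hv hv).sqrt fun z hz ↦
    (metricForm_self_pos (hys hz) (hv0 z hz)).ne'

theorem ContDiffOn.chartArea {E : Type*} [NormedAddCommGroup E] [NormedSpace ℝ E] {s : Set E}
    {y u v : E → Plane} {p : M} (hy : ContDiffOn ℝ ∞ y s)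
    (hys : MapsTo y s (extChartAt (𝓡 2) p).target) (hu : ContDiffOn ℝ ∞ u s)
    (hv : ContDiffOn ℝ ∞ v s) : ContDiffOn ℝ ∞ (fun z ↦ chartArea p (y z) (u z) (v z)) s := by
  have h (i : Fin 2) := contDiffOn_euclidean.1 hu i
  have h' (i : Fin 2) := contDiffOn_euclidean.1 hv i
  refine (((contDiffOn_det_metricMatrix p).comp hy hys).sqrt fun z hz ↦
    (det_metricMatrix_pos (hys hz)).ne').mul (((h 0).mul (h' 1)).sub ((h 1).mul (h' 0)))

theorem contDiffOn_rescaledCovDeriv {p : M} {γ : ℝ → M} {w : ℝ → Plane} {s : Set ℝ}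
    (hγ : ContDiffOn ℝ ∞ (chartCurve p γ) s)
    (hs : MapsTo (chartCurve p γ) s (extChartAt (𝓡 2) p).target) (hw : ContDiff ℝ ∞ w) :
    ContDiffOn ℝ ∞ (rescaledCovDeriv p γ w) s :=
  (contDiff_infty_iff_deriv.1 hw).2.contDiffOn.add
    (contDiffOn_id.smul (ContDiffOn.christoffelVec hγ hs hw.contDiffOn hw.contDiffOn))

/-- The half-arclength parameter and the normalized curvature near a 3/2-cusp. -/
theorem IsThreeHalvesCusp.exists_normalizedCurvature_eq {o : SurfaceOrientation M} {γ : ℝ → M}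
    {δ : ℝ} (hδ : 0 < δ) (hγ : ContMDiffOn 𝓘(ℝ, ℝ) (𝓡 2) ∞ γ (Ioo (-δ) δ))
    (hc : IsThreeHalvesCusp γ) :
    IsLocalDiffeomorphAt 𝓘(ℝ, ℝ) 𝓘(ℝ, ℝ) ∞ (halfArclength γ) 0 ∧
    (∀ᶠ t in 𝓝[≠] (0 : ℝ), velocity γ t ≠ 0) ∧
    ∃ ε > 0, ∃ h : ℝ → ℝ, ContDiffOn ℝ ∞ h (Ioo (-ε) ε) ∧
      (∀ t ∈ Ioo (-ε) ε, t ≠ 0 → normalizedCurvature o γ t = h t) ∧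
      h 0 = cuspidalCurvature o γ / (2 * √2) := by
  have hγ' : ∀ᶠ t in 𝓝 0, ContMDiffAt 𝓘(ℝ, ℝ) (𝓡 2) ∞ γ t := by
    filter_upwards [isOpen_Ioo.mem_nhds (⟨by linarith, hδ⟩ : (0 : ℝ) ∈ Ioo (-δ) δ)] with t ht
    exact hγ.contMDiffAt (isOpen_Ioo.mem_nhds ht)
  have hγ0 := hγ'.self_of_nhds.continuousAt
  set p := γ 0 with hp_def
  have hsource : ∀ᶠ t in 𝓝 0, γ t ∈ (chartAt Plane p).source :=
    hγ0.eventually ((chartAt Plane p).open_source.mem_nhds (mem_chart_source Plane p))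
  obtain ⟨r₀, hr₀, h₀⟩ := exists_Ioo_of_eventually (hγ'.and hsource)
  have hmem {r : ℝ} (hr : 0 < r) : Ioo (-r) r ∈ 𝓝 (0 : ℝ) := Ioo_mem_nhds (by linarith) hr
  have hcurve : ContDiffOn ℝ ∞ (chartCurve p γ) (Ioo (-r₀) r₀) := fun t ht ↦
    (contDiffAt_chartCurve (h₀ t ht).1 (h₀ t ht).2).contDiffWithinAt
  obtain ⟨x, hx, hxγ⟩ := exists_contDiff_eventuallyEq hcurve (hmem hr₀)
  obtain ⟨w, hw, hw0, hxw⟩ := hc.exists_deriv_eq hγ0 hx hxγ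
  have hd : ∀ᶠ t in 𝓝 0, HasDerivAt (chartCurve p γ) (t • w t) t := by
    filter_upwards [hxγ.eventuallyEq_nhds] with t ht
    rw [← hxw t]
    exact (hx.differentiable (by simp) t).hasDerivAt.congr_of_eventuallyEq ht.symm
  have hwne : ∀ᶠ t in 𝓝 0, w t ≠ 0 := hw.continuous.continuousAt.eventually_ne hw0
  obtain ⟨ε, -, hε⟩ := exists_bracket_eq o p
  have hbr : ∀ᶠ t in 𝓝 0, ∀ v v' : TangentSpace (𝓡 2) (γ t), bracket o v v' =
      ε * chartArea p (chartCurve p γ t) (components p v) (components p v') := by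
    filter_upwards [hγ0.eventually hε] with t ht v v'
    rw [ht, mul_assoc]
    rfl
  obtain ⟨r₁, hr₁, h₁⟩ := exists_Ioo_of_eventually
    (hγ'.and (hsource.and (hd.and (hwne.and hbr))))
  have htarget : MapsTo (chartCurve p γ) (Ioo (-r₁) r₁) (extChartAt (𝓡 2) p).target := fun t ht ↦
    (extChartAt (𝓡 2) p).map_source (by rw [extChartAt_source]; exact (h₁ t ht).2.1)
  have hcurve₁ : ContDiffOn ℝ ∞ (chartCurve p γ) (Ioo (-r₁) r₁) := fun t ht ↦
    (contDiffAt_chartCurve (h₁ t ht).1 (h₁ t ht).2.1).contDiffWithinAt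
  have hnorm : ContDiffOn ℝ ∞ (fun t ↦ chartNorm p (chartCurve p γ t) (w t)) (Ioo (-r₁) r₁) :=
    ContDiffOn.chartNorm hcurve₁ htarget hw.contDiffOn fun t ht ↦ (h₁ t ht).2.2.2.1
  obtain ⟨c, hcs, hcn⟩ := exists_contDiff_eventuallyEq hnorm (hmem hr₁)
  have hc0 : 0 < c 0 := by
    rw [hcn.self_of_nhds]
    exact chartNorm_pos (htarget ⟨by linarith, hr₁⟩) hw0
  let m := radialMean 1 c
  have hm : ContDiff ℝ ∞ m := contDiff_radialMean 1 hcs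
  have hm0 : m 0 = c 0 / 2 := by
    change radialMean 1 c 0 = _
    rw [radialMean_zero, smul_eq_mul]
    norm_num
    ring
  have hmpos : ∀ᶠ t in 𝓝 0, 0 < m t :=
    hm.continuous.continuousAt.eventually_const_lt (by rw [hm0]; positivity)
  obtain ⟨r, hr, h⟩ := exists_Ioo_of_eventually
    (hcn.and (hmpos.and (Ioo_mem_nhds (by linarith : -r₁ < 0) hr₁)))
  have hI : Ioo (-r) r ⊆ Ioo (-r₁) r₁ := fun t ht ↦ (h t ht).2.2
  have hnv {t : ℝ} (ht : t ∈ Ioo (-r) r) : ‖velocity γ t‖ = |t| * c t := by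
    obtain ⟨a1, a2, a3, -⟩ := h₁ t (hI ht)
    rw [norm_velocity_eq a1 a2 a3, (h t ht).1]
  -- The speed formula is needed on the whole segment from 0 to t, which lies in the symmetric
  -- interval.
  have hs {t : ℝ} (ht : t ∈ Ioo (-r) r) : arclength γ t = |t| * t * m t :=
    arclength_eq fun u hu ↦ hnv (abs_lt.1 (hu.trans_lt (abs_lt.2 ht)))
  have hτ : EqOn (halfArclength γ) (fun t ↦ t * √(m t)) (Ioo (-r) r) := fun t ht ↦
    halfArclength_eq (hs ht) (h t ht).2.1.le
  have hsqrt : ContDiffOn ℝ ∞ (fun t ↦ √(m t)) (Ioo (-r) r) :=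
    hm.contDiffOn.sqrt fun t ht ↦ (h t ht).2.1.ne'
  refine ⟨?_, ?_, r, hr, fun t ↦ √(m t) * (ε * chartArea p (chartCurve p γ t) (w t)
    (rescaledCovDeriv p γ w t)) / chartNorm p (chartCurve p γ t) (w t) ^ 3, ?_, ?_, ?_⟩
  · have h1 : ContDiffOn ℝ ∞ (halfArclength γ) (Ioo (-r) r) :=
      (contDiffOn_id.mul hsqrt).congr hτ
    have h2 := (hasDerivAt_id' (0 : ℝ)).fun_mul
      ((hsqrt.contDiffAt (hmem hr)).differentiableAt (by simp)).hasDerivAt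
    refine isLocalDiffeomorphAt_of_hasDerivAt h1 (hmem hr)
      (h2.congr_of_eventuallyEq (hτ.eventuallyEq_of_mem (hmem hr))) ?_
    rw [one_mul, zero_mul, add_zero, hm0]
    positivity
  · filter_upwards [nhdsWithin_le_nhds (hmem hr), self_mem_nhdsWithin] with t ht ht0 hv
    have h1 := hnv ht
    rw [hv, norm_zero, (h t ht).1] at h1
    exact (mul_pos (abs_pos.2 ht0)
      (chartNorm_pos (htarget (hI ht)) (h₁ t (hI ht)).2.2.2.1)).ne h1
  · refine (hsqrt.mul (contDiffOn_const.mul (ContDiffOn.chartArea (hcurve₁.mono hI)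
      (htarget.mono_left hI) hw.contDiffOn (contDiffOn_rescaledCovDeriv (hcurve₁.mono hI)
      (htarget.mono_left hI) hw)))).div ((hnorm.mono hI).pow 3) fun t ht ↦ ?_
    exact (pow_pos (chartNorm_pos (htarget (hI ht)) (h₁ t (hI ht)).2.2.2.1) 3).ne'
  · intro t ht ht0
    have hnhds : ∀ᶠ s in 𝓝 t, s ∈ Ioo (-r₁) r₁ := isOpen_Ioo.mem_nhds (hI ht)
    obtain ⟨-, a2, -, -, a5⟩ := h₁ t (hI ht)
    exact normalizedCurvature_eq (hnhds.mono fun s hs ↦ (h₁ s hs).1) a2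
      (hnhds.mono fun s hs ↦ (h₁ s hs).2.2.1) (hw.differentiable (by simp) t) a5 (hs ht)
      (h t ht).2.1.le ht0
  · have h00 : (0 : ℝ) ∈ Ioo (-r₁) r₁ := ⟨by linarith, hr₁⟩
    have hD : DifferentiableAt ℝ (rescaledCovDeriv p γ w) 0 :=
      ((contDiffOn_rescaledCovDeriv hcurve₁ htarget hw).contDiffAt
        (hmem hr₁)).differentiableAt (by simp)
    have hwd : ∀ᶠ s in 𝓝 (0 : ℝ), DifferentiableAt ℝ w s :=
      .of_forall fun s ↦ hw.differentiable (by simp) s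
    have hacc := components_acceleration_eq hγ' (mem_chart_source Plane p) hd hwd.self_of_nhds
    rw [zero_smul, add_zero] at hacc
    have hthird := components_thirdDeriv_zero hγ' hd hwd hD
    have hnacc : ‖acceleration γ 0‖ = c 0 := by
      rw [← chartNorm_components (mem_chart_source Plane p), hacc, hcn.self_of_nhds]
      rfl
    have hD0 : rescaledCovDeriv p γ w 0 = deriv w 0 := by
      rw [rescaledCovDeriv, zero_smul, add_zero]
    have hcn0 : chartNorm p (chartCurve p γ 0) (w 0) = c 0 := hcn.self_of_nhds.symm
    beta_reduce
    rw [cuspidalCurvature, hbr.self_of_nhds, hacc, hthird, hnacc, hcn0, hD0, hm0,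
      chartArea_smul_right]
    -- What remains is √(c/2) A / c³ = 2 A / (c^(5/2) · 2√2) with c = c(0), up to the common factor
    -- ε.
    set A := chartArea p (chartCurve p γ 0) (w 0) (deriv w 0)
    have hpow : c 0 ^ (5 / 2 : ℝ) = c 0 ^ 2 * √(c 0) := by
      rw [Real.sqrt_eq_rpow, ← Real.rpow_natCast, ← Real.rpow_add hc0]
      norm_num
    rw [hpow, Real.sqrt_div hc0.le]
    have h3 : √(c 0) ^ 2 = c 0 := Real.sq_sqrt hc0.le
    have h4 : 0 < √(c 0) := Real.sqrt_pos.2 hc0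
    set k := √(c 0)
    rw [← h3]
    field_simp

end Cusp

/-! ### Smooth local solutions of differential equations -/

section SmoothODE

theorem eq_of_hasDerivAt_zero {f : ℝ → ℝ} {r : ℝ} (hf : ∀ t ∈ Ioo (-r) r, HasDerivAt f 0 t)
    {t : ℝ} (ht : t ∈ Ioo (-r) r) : f t = f 0 := by
  have hr : 0 < r := by linarith [ht.1, ht.2]
  exact isOpen_Ioo.is_const_of_deriv_eq_zero isPreconnected_Ioo
    (fun s hs ↦ (hf s hs).differentiableAt.differentiableWithinAt) (fun s hs ↦ (hf s hs).deriv)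
    ht ⟨by linarith, hr⟩

/-- A smooth time-dependent differential equation has a smooth local solution. -/
theorem exists_contDiffOn_hasDerivAt {E : Type*} [NormedAddCommGroup E] [NormedSpace ℝ E]
    [CompleteSpace E] {V : ℝ × E → E} {s : Set (ℝ × E)} (hs : IsOpen s) (hV : ContDiffOn ℝ ∞ V s)
    {z₀ : E} (h0 : (0, z₀) ∈ s) :
    ∃ r > 0, ∃ z : ℝ → E, z 0 = z₀ ∧ ContDiffOn ℝ ∞ z (Ioo (-r) r) ∧
      ∀ t ∈ Ioo (-r) r, (t, z t) ∈ s ∧ HasDerivAt z (V (t, z t)) t := by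
  -- Time is adjoined as a coordinate with derivative 1, which makes the equation autonomous; `hfst`
  -- recovers that this coordinate equals t.
  let W : ℝ × E → ℝ × E := fun y ↦ (1, V y)
  have hW : ContDiffOn ℝ ∞ W s := contDiffOn_const.prodMk hV
  obtain ⟨α, hα0, ε, hε, hα⟩ :=
    ContDiffAt.exists_forall_mem_closedBall_exists_eq_forall_mem_Ioo_hasDerivAt₀
      ((hW.contDiffAt (hs.mem_nhds h0)).of_le (by norm_cast)) 0
  rw [zero_sub, zero_add] at hα
  have hε0 : (0 : ℝ) ∈ Ioo (-ε) ε := ⟨by linarith, hε⟩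
  have hmem : ∀ᶠ t in 𝓝 (0 : ℝ), α t ∈ s :=
    (hα 0 hε0).continuousAt.eventually (by rw [hα0]; exact hs.mem_nhds h0)
  obtain ⟨ρ, hρ, h⟩ := exists_Ioo_of_eventually (hmem.and (isOpen_Ioo.mem_nhds hε0))
  have hr : 0 < ρ / 2 := by linarith
  have hsub : Icc (-(ρ / 2)) (ρ / 2) ⊆ Ioo (-ρ) ρ := fun t ht ↦
    ⟨by linarith [ht.1], by linarith [ht.2]⟩
  have hsm : ContDiffOn ℝ ∞ α (Icc (-(ρ / 2)) (ρ / 2)) := by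
    refine ODE.contDiffOn_enat_Icc_of_hasDerivWithinAt (n := ⊤) (f := fun _ ↦ W) (u := s)
      (hW.comp contDiffOn_snd fun y hy ↦ hy.2)
      (fun t ht ↦ (hα t (h t (hsub ht)).2).hasDerivWithinAt) fun t ht ↦ (h t (hsub ht)).1
  have hfst {t : ℝ} (ht : t ∈ Ioo (-(ρ / 2)) (ρ / 2)) : (α t).1 = t := by
    have h1 := eq_of_hasDerivAt_zero (f := fun t ↦ (α t).1 - t) (fun u hu ↦ by
      have := ((hasFDerivAt_fst (𝕜 := ℝ) (p := α u)).comp_hasDerivAt u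
        (hα u (h u (hsub (Ioo_subset_Icc_self hu))).2)).fun_sub (hasDerivAt_id' u)
      simpa [W] using this) ht
    simp only [hα0, sub_zero] at h1
    linarith
  have heq {t : ℝ} (ht : t ∈ Ioo (-(ρ / 2)) (ρ / 2)) : (t, (α t).2) = α t :=
    Prod.ext (hfst ht).symm rfl
  refine ⟨ρ / 2, hr, fun t ↦ (α t).2, congrArg Prod.snd hα0,
    contDiff_snd.comp_contDiffOn (hsm.mono Ioo_subset_Icc_self), fun t ht ↦ ?_⟩
  have ht' := h t (hsub (Ioo_subset_Icc_self ht))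
  rw [heq ht]
  exact ⟨ht'.1, (hasFDerivAt_snd (𝕜 := ℝ) (p := α t)).comp_hasDerivAt t (hα t ht'.2)⟩

end SmoothODE

/-! ### The differential equation for prescribed curvature -/

section PrescribedCurvature

variable {M : Type*} [TopologicalSpace M] [ChartedSpace Plane M] [IsManifold (𝓡 2) ∞ M]
  [RiemannianBundle (fun p : M ↦ TangentSpace (𝓡 2) p)]

/-- The rotation by a right angle with respect to the metric in the chart at `p`. -/
noncomputable def chartRot (p : M) (y v : Plane) : Plane :=
  (√(metricMatrix p y).det)⁻¹ • !₂[-(metricMatrix p y 1 0 * v 0 + metricMatrix p y 1 1 * v 1),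
    metricMatrix p y 0 0 * v 0 + metricMatrix p y 0 1 * v 1]

/-- Up to the factor 1/√det g, the rotated vector is (-v₁, v₀), where v₀, v₁ are the components of v
with lowered index; pairing it with v gives -v₁ v₀ + v₀ v₁. -/
theorem metricForm_chartRot (p : M) (y v : Plane) : metricForm p y (chartRot p y v) v = 0 := by
  simp only [metricForm_apply, chartRot, Fin.sum_univ_two, PiLp.smul_apply, smul_eq_mul]
  simp
  ring

theorem chartArea_chartRot {p : M} {y : Plane} (hy : y ∈ (extChartAt (𝓡 2) p).target) (v : Plane) :
    chartArea p y v (chartRot p y v) = metricForm p y v v := by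
  have h := mul_inv_cancel₀ (Real.sqrt_pos.2 (det_metricMatrix_pos hy)).ne'
  simp only [metricForm_apply, chartRot, chartArea, Fin.sum_univ_two, PiLp.smul_apply, smul_eq_mul]
  simp
  linear_combination (v 0 * (metricMatrix p y 0 0 * v 0 + metricMatrix p y 0 1 * v 1) +
    v 1 * (metricMatrix p y 1 0 * v 0 + metricMatrix p y 1 1 * v 1)) * h

variable [IsContMDiffRiemannianBundle (𝓡 2) ∞ Plane (fun p : M ↦ TangentSpace (𝓡 2) p)]

theorem ContDiffOn.chartRot {E : Type*} [NormedAddCommGroup E] [NormedSpace ℝ E] {s : Set E}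
    {y v : E → Plane} {p : M} (hy : ContDiffOn ℝ ∞ y s)
    (hys : MapsTo y s (extChartAt (𝓡 2) p).target) (hv : ContDiffOn ℝ ∞ v s) :
    ContDiffOn ℝ ∞ (fun z ↦ chartRot p (y z) (v z)) s := by
  have h (i : Fin 2) := contDiffOn_euclidean.1 hv i
  have hm (i j : Fin 2) := (contDiffOn_metricMatrix p i j).comp hy hys
  refine ((((contDiffOn_det_metricMatrix p).comp hy hys).sqrt fun z hz ↦
    (det_metricMatrix_pos (hys hz)).ne').inv fun z hz ↦
      (Real.sqrt_pos.2 (det_metricMatrix_pos (hys hz))).ne').smul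
        (contDiffOn_euclidean.2 fun i ↦ ?_)
  fin_cases i
  · exact (((hm 1 0).mul (h 0)).add ((hm 1 1).mul (h 1))).neg
  · exact ((hm 0 0).mul (h 0)).add ((hm 0 1).mul (h 1))

/-- Along a curve with velocity `t w`, the length of `w` is constant if the covariant derivative of
`w` is proportional to the rotation of `w`. -/
theorem hasDerivAt_metricForm_self {p : M} {x w : ℝ → Plane} {t a : ℝ}
    (hxt : x t ∈ (extChartAt (𝓡 2) p).target) (hx : HasDerivAt x (t • w t) t)
    (hw : HasDerivAt w (a • chartRot p (x t) (w t) - t • christoffelVec p (x t) (w t) (w t)) t) :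
    HasDerivAt (fun t ↦ metricForm p (x t) (w t) (w t)) 0 t := by
  have hB : HasFDerivAt (metricForm p) (fderiv ℝ (metricForm p) (x t)) (x t) :=
    (((contDiffOn_metricForm p).contDiffAt
      ((isOpen_extChartAt_target p).mem_nhds hxt)).differentiableAt (by simp)).hasFDerivAt
  have h := ((hB.comp_hasDerivAt t hx).clm_apply hw).clm_apply hw
  refine h.congr_deriv ?_
  -- By the Koszul formula g(Γ(w, w), w) is half the derivative of g(w, w) in the direction w with w
  -- frozen. So the Christoffel term cancels the variation of the metric, and the rotation term is
  -- orthogonal to w.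
  have hchr := metricForm_christoffelVec hxt (w t) (w t) (w t)
  have hrot := metricForm_chartRot p (x t) (w t)
  have hsymm := metricForm_symm p (x t) (w t)
  simp only [map_smul, add_apply, smul_apply, smul_eq_mul, Function.comp_apply, map_sub, sub_apply,
    hsymm, hchr, hrot]
  ring

/-- There is a curve of constant rescaled speed `2` with prescribed rescaled curvature, in the
chart at `p`. -/
theorem exists_curve_in_chart (p : M) {f : ℝ → ℝ} (hf : ContDiff ℝ ∞ f) :
    ∃ r > 0, ∃ x w : ℝ → Plane, x 0 = extChartAt (𝓡 2) p p ∧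
      ContDiffOn ℝ ∞ x (Ioo (-r) r) ∧ ContDiffOn ℝ ∞ w (Ioo (-r) r) ∧
      ∀ t ∈ Ioo (-r) r, x t ∈ (extChartAt (𝓡 2) p).target ∧ HasDerivAt x (t • w t) t ∧
        HasDerivAt w
          (f t • chartRot p (x t) (w t) - t • christoffelVec p (x t) (w t) (w t)) t ∧
        metricForm p (x t) (w t) (w t) = 4 := by
  set x₀ := extChartAt (𝓡 2) p p with hx₀
  have hx₀t : x₀ ∈ (extChartAt (𝓡 2) p).target := mem_extChartAt_target p
  let e : Plane := EuclideanSpace.single 0 1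
  have he : 0 < metricForm p x₀ e e := metricForm_self_pos hx₀t (by
    intro h
    have := congrArg (· 0) h
    simp [e] at this)
  -- The length 2 makes the speed 2|t| and hence the arclength |t| t, so that τ(t) = t.
  let w₀ : Plane := (2 * (√(metricForm p x₀ e e))⁻¹) • e
  have hw₀ : metricForm p x₀ w₀ w₀ = 4 := by
    have h1 := Real.sq_sqrt he.le
    have h2 : √(metricForm p x₀ e e) ≠ 0 := (Real.sqrt_pos.2 he).ne'
    simp only [w₀, map_smul, smul_apply, smul_eq_mul]
    set k := √(metricForm p x₀ e e)
    rw [← h1]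
    field_simp
    norm_num
  let s : Set (ℝ × Plane × Plane) := {y | y.2.1 ∈ (extChartAt (𝓡 2) p).target}
  have hs : IsOpen s := (isOpen_extChartAt_target p).preimage (continuous_fst.comp continuous_snd)
  let V : ℝ × Plane × Plane → Plane × Plane := fun y ↦ (y.1 • y.2.2,
    f y.1 • chartRot p y.2.1 y.2.2 - y.1 • christoffelVec p y.2.1 y.2.2 y.2.2)
  have h1 : ContDiffOn ℝ ∞ (fun y : ℝ × Plane × Plane ↦ y.2.1) s :=
    (contDiff_fst.comp contDiff_snd).contDiffOn
  have h2 : ContDiffOn ℝ ∞ (fun y : ℝ × Plane × Plane ↦ y.2.2) s :=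
    (contDiff_snd.comp contDiff_snd).contDiffOn
  have h3 : MapsTo (fun y : ℝ × Plane × Plane ↦ y.2.1) s (extChartAt (𝓡 2) p).target :=
    fun y hy ↦ hy
  have hV : ContDiffOn ℝ ∞ V s :=
    (contDiffOn_fst.smul h2).prodMk (((hf.comp contDiff_fst).contDiffOn.smul
      (ContDiffOn.chartRot h1 h3 h2)).sub (contDiffOn_fst.smul
        (ContDiffOn.christoffelVec h1 h3 h2 h2)))
  obtain ⟨r, hr, z, hz0, hz, h⟩ := exists_contDiffOn_hasDerivAt hs hV (z₀ := (x₀, w₀)) hx₀t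
  have hd (t : ℝ) (ht : t ∈ Ioo (-r) r) : (z t).1 ∈ (extChartAt (𝓡 2) p).target ∧
      HasDerivAt (fun t ↦ (z t).1) (t • (z t).2) t ∧ HasDerivAt (fun t ↦ (z t).2)
        (f t • chartRot p (z t).1 (z t).2 - t • christoffelVec p (z t).1 (z t).2 (z t).2) t :=
    ⟨(h t ht).1, (hasFDerivAt_fst (𝕜 := ℝ) (p := z t)).comp_hasDerivAt t (h t ht).2,
      (hasFDerivAt_snd (𝕜 := ℝ) (p := z t)).comp_hasDerivAt t (h t ht).2⟩
  refine ⟨r, hr, fun t ↦ (z t).1, fun t ↦ (z t).2, congrArg Prod.fst hz0,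
    contDiff_fst.comp_contDiffOn hz, contDiff_snd.comp_contDiffOn hz, fun t ht ↦ ?_⟩
  obtain ⟨a1, a2, a3⟩ := hd t ht
  refine ⟨a1, a2, a3, ?_⟩
  have h4 := eq_of_hasDerivAt_zero (f := fun t ↦ metricForm p (z t).1 (z t).2 (z t).2)
    (fun u hu ↦ hasDerivAt_metricForm_self (hd u hu).1 (hd u hu).2.1 (hd u hu).2.2) ht
  simp only [hz0, hw₀] at h4
  exact h4

end PrescribedCurvature

/-! ### Converse part: cusps with prescribed normalized curvature -/

section Existence

variable {M : Type*} [TopologicalSpace M] [ChartedSpace Plane M] [IsManifold (𝓡 2) ∞ M]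
  [RiemannianBundle (fun p : M ↦ TangentSpace (𝓡 2) p)]
  [IsContMDiffRiemannianBundle (𝓡 2) ∞ Plane (fun p : M ↦ TangentSpace (𝓡 2) p)]

/-- A smooth function with `f 0 ≠ 0` is the normalized curvature of a 3/2-cusp, as a function of
the half-arclength parameter. -/
theorem exists_isThreeHalvesCusp_normalizedCurvature_eq (o : SurfaceOrientation M) (p : M)
    {δ : ℝ} {f : ℝ → ℝ} (hδ : 0 < δ) (hf : ContDiffOn ℝ ∞ f (Ioo (-δ) δ)) (hf0 : f 0 ≠ 0) :
    ∃ (r : ℝ) (γ : ℝ → M), 0 < r ∧ r ≤ δ ∧ γ 0 = p ∧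
      ContMDiffOn 𝓘(ℝ, ℝ) (𝓡 2) ∞ γ (Ioo (-r) r) ∧ IsThreeHalvesCusp γ ∧
      ∀ t ∈ Ioo (-r) r, halfArclength γ t = t ∧
        (t ≠ 0 → velocity γ t ≠ 0 ∧ normalizedCurvature o γ t = f t) := by
  have hmem {r : ℝ} (hr : 0 < r) : Ioo (-r) r ∈ 𝓝 (0 : ℝ) := Ioo_mem_nhds (by linarith) hr
  obtain ⟨F, hF, hFf⟩ := exists_contDiff_eventuallyEq hf (hmem hδ)
  obtain ⟨ε, hε, hbr⟩ := exists_bracket_eq o p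
  have hε2 : ε * ε = 1 := by rcases hε with rfl | rfl <;> norm_num
  -- For D = a J w with |w| = 2 the normalized curvature is ε a · 4 / 2³, so a = 2 ε f is required,
  -- as ε² = 1.
  obtain ⟨r₀, hr₀, x, w, hx0, hxs, hws, h₀⟩ := exists_curve_in_chart p (f := fun t ↦ 2 * ε * F t)
    (contDiff_const.mul hF)
  let γ : ℝ → M := fun t ↦ (extChartAt (𝓡 2) p).symm (x t)
  have hγ0 : γ 0 = p := by
    change (extChartAt (𝓡 2) p).symm (x 0) = p
    rw [hx0, extChartAt_to_inv]
  have hγs : ContMDiffOn 𝓘(ℝ, ℝ) (𝓡 2) ∞ γ (Ioo (-r₀) r₀) :=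
    (contMDiffOn_extChartAt_symm p).comp hxs.contMDiffOn fun t ht ↦ (h₀ t ht).1
  have hγ {t : ℝ} (ht : t ∈ Ioo (-r₀) r₀) : ContMDiffAt 𝓘(ℝ, ℝ) (𝓡 2) ∞ γ t :=
    hγs.contMDiffAt (isOpen_Ioo.mem_nhds ht)
  have hcurve : EqOn (chartCurve p γ) x (Ioo (-r₀) r₀) := fun t ht ↦
    (extChartAt (𝓡 2) p).right_inv (h₀ t ht).1
  have hsource {t : ℝ} (ht : t ∈ Ioo (-r₀) r₀) : γ t ∈ (chartAt Plane p).source := by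
    rw [← extChartAt_source (𝓡 2)]
    exact (extChartAt (𝓡 2) p).map_target (h₀ t ht).1
  have hd {t : ℝ} (ht : t ∈ Ioo (-r₀) r₀) : HasDerivAt (chartCurve p γ) (t • w t) t :=
    (h₀ t ht).2.1.congr_of_eventuallyEq (hcurve.eventuallyEq_of_mem (isOpen_Ioo.mem_nhds ht))
  have hnorm {t : ℝ} (ht : t ∈ Ioo (-r₀) r₀) : chartNorm p (chartCurve p γ t) (w t) = 2 := by
    rw [chartNorm, hcurve ht, (h₀ t ht).2.2.2, show (4 : ℝ) = 2 ^ 2 by norm_num,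
      Real.sqrt_sq zero_le_two]
  have hnv {t : ℝ} (ht : t ∈ Ioo (-r₀) r₀) : ‖velocity γ t‖ = |t| * 2 := by
    rw [norm_velocity_eq (hγ ht) (hsource ht) (hd ht), hnorm ht]
  have hmean (t : ℝ) : radialMean 1 (fun _ ↦ (2 : ℝ)) t = 1 := by
    simp [radialMean]
  have hs {t : ℝ} (ht : t ∈ Ioo (-r₀) r₀) : arclength γ t = |t| * t * 1 := by
    rw [← hmean t]
    exact arclength_eq fun u hu ↦ hnv (abs_lt.1 (hu.trans_lt (abs_lt.2 ht)))
  have hbr' : ∀ᶠ t in 𝓝 0, ∀ v v' : TangentSpace (𝓡 2) (γ t), bracket o v v' =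
      ε * chartArea p (chartCurve p γ t) (components p v) (components p v') := by
    have hc : Tendsto γ (𝓝 0) (𝓝 p) := by
      simpa only [hγ0] using (hγ ⟨by linarith, hr₀⟩).continuousAt.tendsto
    filter_upwards [hc.eventually hbr] with t ht v v'
    rw [ht, mul_assoc]
    rfl
  obtain ⟨r, hr, h⟩ := exists_Ioo_of_eventually
    (hbr'.and (hFf.and (inter_mem (hmem hr₀) (hmem hδ))))
  have hrδ : r ≤ δ := by
    -- Otherwise δ would lie in (-r, r), which is contained in (-δ, δ).
    by_contra! hlt
    exact lt_irrefl δ (h δ ⟨by linarith, hlt⟩).2.2.2.2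
  have hI : Ioo (-r) r ⊆ Ioo (-r₀) r₀ := fun t ht ↦ (h t ht).2.2.1
  refine ⟨r, γ, hr, hrδ, hγ0, hγs.mono hI, ?_, fun t ht ↦ ⟨?_, fun ht0 ↦ ⟨fun hv ↦ ?_, ?_⟩⟩⟩
  · have h00 : (0 : ℝ) ∈ Ioo (-r₀) r₀ := ⟨by linarith, hr₀⟩
    obtain ⟨W, hW, hWw⟩ := exists_contDiff_eventuallyEq hws (hmem hr₀)
    refine isThreeHalvesCusp_of_deriv_eq hW ?_ ?_
    · rw [hγ0]
      filter_upwards [hWw, hmem hr₀] with t ht ht'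
      rw [ht]
      exact hd ht'
    -- At t = 0 the Christoffel term vanishes and w' = 2 ε f(0) J w. The area of w and J w is 4, so
    -- f(0) ≠ 0 makes w(0) and w'(0) independent.
    · obtain ⟨b1, -, b3, b4⟩ := h₀ 0 h00
      rw [hWw.deriv_eq, b3.deriv, hWw.self_of_nhds, zero_smul, sub_zero]
      have ha := chartArea_chartRot b1 (w 0)
      rw [b4, chartArea] at ha
      intro h0
      simp only [PiLp.smul_apply, smul_eq_mul] at h0
      have hne : 2 * ε * F 0 ≠ 0 := by
        rw [hFf.self_of_nhds]
        rcases hε with rfl | rfl <;> simpa using hf0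
      have h1 : w 0 0 * chartRot p (x 0) (w 0) 1 - w 0 1 * chartRot p (x 0) (w 0) 0 = 0 :=
        (mul_eq_zero.1 (by linear_combination h0 :
          2 * ε * F 0 * (w 0 0 * chartRot p (x 0) (w 0) 1 - w 0 1 * chartRot p (x 0) (w 0) 0) =
            0)).resolve_left hne
      rw [h1, mul_zero] at ha
      norm_num at ha
  · rw [halfArclength_eq (hs (hI ht)) zero_le_one, Real.sqrt_one, mul_one]
  · have h1 := hnv (hI ht)
    rw [hv, norm_zero] at h1
    exact (mul_pos (abs_pos.2 ht0) two_pos).ne h1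
  · have hnhds : Ioo (-r₀) r₀ ∈ 𝓝 t := isOpen_Ioo.mem_nhds (hI ht)
    obtain ⟨b1, -, b3, b4⟩ := h₀ t (hI ht)
    have hcov : rescaledCovDeriv p γ w t = (2 * ε * F t) • chartRot p (x t) (w t) := by
      rw [rescaledCovDeriv, b3.deriv, hcurve (hI ht), sub_add_cancel]
    rw [normalizedCurvature_eq (mem_of_superset hnhds fun s hs ↦ hγ hs) (hsource (hI ht))
      (mem_of_superset hnhds fun s hs ↦ hd hs) b3.differentiableAt (h t ht).1 (hs (hI ht))
      zero_le_one ht0, hnorm (hI ht), hcov, chartArea_smul_right, hcurve (hI ht),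
      chartArea_chartRot b1, b4, (h t ht).2.1, Real.sqrt_one]
    linear_combination f t * hε2

end Existence

end CuspCurvature

/-! ### The theorem -/

open CuspCurvature in
theorem theorem2p6 {M : Type*} [TopologicalSpace M] [ChartedSpace Plane M]
    [IsManifold (𝓡 2) ∞ M]
    [RiemannianBundle (fun p : M ↦ TangentSpace (𝓡 2) p)]
    [IsContMDiffRiemannianBundle (𝓡 2) ∞ Plane (fun p : M ↦ TangentSpace (𝓡 2) p)]
    (o : SurfaceOrientation M) :
    (∀ (δ : ℝ) (γ : ℝ → M), 0 < δ →
      ContMDiffOn 𝓘(ℝ, ℝ) (𝓡 2) ∞ γ (Ioo (-δ) δ) → IsThreeHalvesCusp γ →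
        -- the half-arclength function is a local coordinate of the curve at `t = 0`
        IsLocalDiffeomorphAt 𝓘(ℝ, ℝ) 𝓘(ℝ, ℝ) ∞ (halfArclength γ) 0 ∧
        -- near the cusp, the curve is regular outside the cusp, so that `κ_g` is defined there
        (∀ᶠ t in 𝓝[≠] (0 : ℝ), velocity γ t ≠ 0) ∧
        -- the normalized curvature is a smooth function of `t`
        (∃ ε > 0, ∃ h : ℝ → ℝ, ContDiffOn ℝ ∞ h (Ioo (-ε) ε) ∧
          ∀ t ∈ Ioo (-ε) ε, t ≠ 0 → normalizedCurvature o γ t = h t) ∧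
        -- the normalized curvature is a smooth function of `τ`
        (∃ ε > 0, ∃ h : ℝ → ℝ, ContDiffOn ℝ ∞ h (Ioo (-ε) ε) ∧
          ∀ᶠ t in 𝓝[≠] (0 : ℝ), normalizedCurvature o γ t = h (halfArclength γ t)) ∧
        Tendsto (normalizedCurvature o γ) (𝓝[≠] 0) (𝓝 (cuspidalCurvature o γ / (2 * √2)))) ∧
    (∀ (p : M) (ε : ℝ) (f : ℝ → ℝ), 0 < ε → ContDiffOn ℝ ∞ f (Ioo (-ε) ε) → f 0 ≠ 0 →
      ∃ (δ : ℝ) (γ : ℝ → M), 0 < δ ∧ δ ≤ ε ∧ γ 0 = p ∧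
        ContMDiffOn 𝓘(ℝ, ℝ) (𝓡 2) ∞ γ (Ioo (-δ) δ) ∧ IsThreeHalvesCusp γ ∧
        ∀ t ∈ Ioo (-δ) δ, halfArclength γ t = t ∧
          (t ≠ 0 → velocity γ t ≠ 0 ∧ normalizedCurvature o γ t = f t)) := by
  refine ⟨fun δ γ hδ hγ hc ↦ ?_, fun p ε f hε hf hf0 ↦
    exists_isThreeHalvesCusp_normalizedCurvature_eq o p hε hf hf0⟩
  obtain ⟨hτ, hv, ε, hε, h, hh, hκ, h0⟩ := hc.exists_normalizedCurvature_eq (o := o) hδ hγ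
  have hI : Ioo (-ε) ε ∈ 𝓝 (0 : ℝ) := Ioo_mem_nhds (by linarith) hε
  have hκ' : ∀ᶠ t in 𝓝[≠] 0, normalizedCurvature o γ t = h t := by
    filter_upwards [nhdsWithin_le_nhds hI, self_mem_nhdsWithin] with t ht ht0
    exact hκ t ht ht0
  refine ⟨hτ, hv, ⟨ε, hε, h, hh, hκ⟩, ?_, ?_⟩
  · obtain ⟨H, hH, hHh⟩ := exists_contDiff_eventuallyEq hh hI
    obtain ⟨σ, hσ, -, -, -, hστ⟩ := exists_contDiff_local_inverse hτ (by simp [halfArclength])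
    -- As a function of τ, the normalized curvature is composed with the local inverse σ of τ. `H`
    -- and σ are globally smooth, so any radius will do.
    refine ⟨1, one_pos, fun s ↦ H (σ s), (hH.comp hσ).contDiffOn, ?_⟩
    filter_upwards [hκ', nhdsWithin_le_nhds hHh, nhdsWithin_le_nhds hστ] with t h1 h2 h3
    rw [h1, h3, h2]
  · rw [← h0]
    exact ((hh.continuousOn.continuousAt hI).tendsto.mono_left nhdsWithin_le_nhds).congr'
      (hκ'.mono fun t ht ↦ ht.symm)
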